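/- Let $\mathbb K$ be a field. All posets are finite. A rooted tree is a finite oriented graph with a distinguished vertex, the root, which has no incoming edge, such that every other vertex has exactly one incoming edge and every vertex is reached from the root by a directed path; a rooted forest is a finite (possibly empty) disjoint union of rooted trees. The vertices of a rooted forest form a poset: $x\le y$ if and only if there is a directed path from a root to $y$ passing through $x$. Two rooted trees are identified when their posets are isomorphic. Let $\mathcal F$ be the family of all posets isomorphic to the poset of a rooted forest. *The Hopf algebra of rooted trees (Connes--Kreimer).* $\mathcal H_{RT}$ is the free commutative unital $\mathbb K$-algebra on the set of nonempty rooted trees; a rooted forest is identified with the product of its trees. The coproduct of a rooted forest $u$ with vertex set $\mathcal V(u)$ is $$\Delta_{RT}(u)=\sum_{V\amalg W=\mathcal V(u),\ W<V} u|_V\otimes u|_W ,$$ where $W<V$ means that $y<x$ for all comparable $x\in V$, $y\in W$ (an admissible cut, with crown $u|_V$ and trunk $u|_W$, the subforests which keep the edges of $u$ linking two elements of $V$, respectively of $W$). The counit is $1$ on the empty forest and $0$ on the other forests. *Incidence Hopf algebras.* Let $\mathcal P$ be a nonempty family of posets, each with a least element $0_P$ and a greatest element $1_P$, closed under taking intervals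 $[x,y]$ and under direct products (a hereditary family). $\mathcal H(\mathcal P)$ is the $\mathbb K$-vector space with basis the isomorphism classes $\overline P$ of the posets $P\in\mathcal P$, with product $\overline P\cdot\overline Q=\overline{P\times Q}$, coproduct $\Delta(\overline P)=\sum_{x\in P}\overline{[0_P,x]}\otimes\overline{[x,1_P]}$, and counit $1$ on the class of the one-point poset and $0$ on the other classes. For a poset $P$ let $J(P)$ be the poset of its order ideals (downward closed subsets), ordered by inclusion, and let $J(\mathcal F)$ be the family of all posets isomorphic to $J(P)$ for some $P\in\mathcal F$. **Proposition.** (1) The disjoint union of two members of $\mathcal F$ is in $\mathcal F$, and every convex subset of a member of $\mathcal F$, with the induced order, is in $\mathcal F$. (2) $J(\mathcal F)$ is hereditary. The formulas above are well defined and make $\mathcal H_{RT}$ and $\mathcal H(J(\mathcal F))$ Hopf algebras, and these two Hopf algebras are isomorphic. (3) There is an isomorphism of algebras $e:\mathcal H(J(\mathcal F))\to\mathcal H_{RT}$ which sends the class of $J(F)$ to $F$ for every rooted forest $F$, is compatible with the counits, and is compatible with the coproducts up to a flip: $(e\otimes e)\circ\Delta=\tau\circ\Delta_{RT}\circ e$,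 where $\tau(a\otimes b)=b\otimes a$. -/

import Mathlib

open scoped TensorProduct

noncomputable section

namespace IncHopf

universe u

/-! ### Hopf algebra axioms for given data -/

/-- The coproduct and counit carried by the algebra `A` make it a Hopf algebra:
they are coassociative and counital, they are morphisms of unital algebras, and there is
an antipode. -/
structure IsHopf (K A : Type*) [CommSemiring K] [Semiring A] [Algebra K A]
    [CoalgebraStruct K A] : Prop where
  coassoc : TensorProduct.assoc K A A A ∘ₗ
      (CoalgebraStruct.comul (R := K) (A := A)).rTensor A ∘ₗ CoalgebraStruct.comul =
    (CoalgebraStruct.comul (R := K) (A := A)).lTensor A ∘ₗ CoalgebraStruct.comul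
  rTensor_counit : (CoalgebraStruct.counit (R := K) (A := A)).rTensor A ∘ₗ
      CoalgebraStruct.comul = TensorProduct.mk K K A 1
  lTensor_counit : (CoalgebraStruct.counit (R := K) (A := A)).lTensor A ∘ₗ
      CoalgebraStruct.comul = (TensorProduct.mk K A K).flip 1
  counit_one : CoalgebraStruct.counit (R := K) (1 : A) = 1
  counit_mul : ∀ a b : A, CoalgebraStruct.counit (R := K) (a * b) =
    CoalgebraStruct.counit (R := K) a * CoalgebraStruct.counit (R := K) b
  comul_one : CoalgebraStruct.comul (R := K) (1 : A) = 1
  comul_mul : ∀ a b : A, CoalgebraStruct.comul (R := K) (a * b) =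
    CoalgebraStruct.comul (R := K) a * CoalgebraStruct.comul (R := K) b
  exists_antipode : ∃ S : A →ₗ[K] A,
    LinearMap.mul' K A ∘ₗ S.rTensor A ∘ₗ CoalgebraStruct.comul =
        Algebra.linearMap K A ∘ₗ CoalgebraStruct.counit ∧
      LinearMap.mul' K A ∘ₗ S.lTensor A ∘ₗ CoalgebraStruct.comul =
        Algebra.linearMap K A ∘ₗ CoalgebraStruct.counit

/-- Data satisfying `IsHopf` is a Hopf algebra in the sense of Mathlib, with the same algebra
structure, coproduct and counit. -/
@[reducible]
def IsHopf.toHopfAlgebra {K A : Type*} [CommSemiring K] [Semiring A] [Algebra K A]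
    [C : CoalgebraStruct K A] (h : IsHopf K A) : HopfAlgebra K A :=
  letI : Coalgebra K A :=
    { C with
      coassoc := h.coassoc
      rTensor_counit_comp_comul := h.rTensor_counit
      lTensor_counit_comp_comul := h.lTensor_counit }
  letI : Bialgebra K A := Bialgebra.mk' K A h.counit_one (h.counit_mul _ _) h.comul_one
    (h.comul_mul _ _)
  { antipode := h.exists_antipode.choose
    mul_antipode_rTensor_comul := h.exists_antipode.choose_spec.1
    mul_antipode_lTensor_comul := h.exists_antipode.choose_spec.2 }

/-! ### Isomorphism classes of finite posets -/

/-- Two finite posets are equivalent when they are isomorphic. -/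
instance finPosetSetoid : Setoid FinPartOrd.{0} where
  r P Q := Nonempty (P ≃o Q)
  iseqv :=
    ⟨fun P => ⟨OrderIso.refl P⟩, fun ⟨e⟩ => ⟨e.symm⟩, fun ⟨e⟩ ⟨f⟩ => ⟨e.trans f⟩⟩

/-- Isomorphism classes of finite posets. -/
def PosetClass : Type 1 := Quotient finPosetSetoid

/-- The isomorphism class of a finite poset. -/
def PosetClass.mk (P : FinPartOrd.{0}) : PosetClass := Quotient.mk _ P

theorem PosetClass.mk_eq_mk {P Q : FinPartOrd.{0}} :
    PosetClass.mk P = PosetClass.mk Q ↔ Nonempty (P ≃o Q) := Quotient.eq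

/-- Isomorphism classes of finite posets form a commutative monoid under the direct product
(with the componentwise order); the unit is the class of the one-point posets. -/
instance : CommMonoid PosetClass where
  mul := Quotient.map₂ (fun P Q => FinPartOrd.of (P × Q))
    (fun _ _ ⟨e⟩ _ _ ⟨f⟩ => ⟨⟨e.toEquiv.prodCongr f.toEquiv, and_congr e.map_rel_iff f.map_rel_iff⟩⟩)
  one := PosetClass.mk (FinPartOrd.of PUnit)
  mul_assoc := by
    rintro ⟨P⟩ ⟨Q⟩ ⟨R⟩
    exact Quotient.sound ⟨OrderIso.prodAssoc P Q R⟩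
  mul_comm := by
    rintro ⟨P⟩ ⟨Q⟩
    exact Quotient.sound ⟨OrderIso.prodComm⟩
  one_mul := by
    rintro ⟨P⟩
    exact Quotient.sound ⟨⟨Equiv.punitProd P, by
      rintro ⟨a, x⟩ ⟨b, y⟩
      exact ⟨fun h => ⟨le_rfl, h⟩, fun h => h.2⟩⟩⟩
  mul_one := by
    rintro ⟨P⟩
    exact Quotient.sound ⟨⟨Equiv.prodPUnit P, by
      rintro ⟨x, a⟩ ⟨y, b⟩
      exact ⟨fun h => ⟨h, le_rfl⟩, fun h => h.1⟩⟩⟩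

theorem PosetClass.mk_mul_mk (P Q : FinPartOrd.{0}) :
    PosetClass.mk P * PosetClass.mk Q = PosetClass.mk (FinPartOrd.of (P × Q)) := rfl

/-- The class of a poset with exactly one element is the unit. -/
theorem PosetClass.mk_eq_one {P : FinPartOrd.{0}} (x : P) (h : ∀ y : P, y = x) :
    PosetClass.mk P = 1 :=
  PosetClass.mk_eq_mk.2 ⟨⟨⟨fun _ => PUnit.unit, fun _ => x, fun y => (h y).symm, fun _ => rfl⟩, by
    intro a b
    rw [h a, h b]
    exact ⟨fun _ => le_rfl, fun _ => le_rfl⟩⟩⟩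

/-! ### Hereditary families and their incidence Hopf algebras -/

open Classical in
/-- The interval `[x, y]` of a finite poset, as a poset. -/
def interval (P : FinPartOrd.{0}) (x y : P) : FinPartOrd.{0} := FinPartOrd.of (Set.Icc x y)

/-- A nonempty family of finite posets, each with a least element and a greatest element, which is
closed under taking intervals and under direct products. -/
structure IsHereditary (𝓟 : Set FinPartOrd.{0}) : Prop where
  nonempty : 𝓟.Nonempty
  exists_bot : ∀ P ∈ 𝓟, ∃ z : P, IsBot z
  exists_top : ∀ P ∈ 𝓟, ∃ z : P, IsTop z
  interval_mem : ∀ P ∈ 𝓟, ∀ x y : P, x ≤ y → interval P x y ∈ 𝓟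
  prod_mem : ∀ P ∈ 𝓟, ∀ Q ∈ 𝓟, FinPartOrd.of (P × Q) ∈ 𝓟

section Incidence

variable {𝓟 : Set FinPartOrd.{0}} (h : IsHereditary 𝓟)

/-- The least element `0_P` of a member of the family. -/
def IsHereditary.bot {P : FinPartOrd.{0}} (hP : P ∈ 𝓟) : P := (h.exists_bot P hP).choose

theorem IsHereditary.bot_le {P : FinPartOrd.{0}} (hP : P ∈ 𝓟) (x : P) : h.bot hP ≤ x :=
  (h.exists_bot P hP).choose_spec x

/-- The greatest element `1_P` of a member of the family. -/
def IsHereditary.top {P : FinPartOrd.{0}} (hP : P ∈ 𝓟) : P := (h.exists_top P hP).choose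

theorem IsHereditary.le_top {P : FinPartOrd.{0}} (hP : P ∈ 𝓟) (x : P) : x ≤ h.top hP :=
  (h.exists_top P hP).choose_spec x

/-- The monoid of isomorphism classes of members of a hereditary family, the product being
induced by the direct product of posets. -/
def IsHereditary.classes : Submonoid PosetClass where
  carrier := {c | ∃ P ∈ 𝓟, PosetClass.mk P = c}
  one_mem' := by
    obtain ⟨P, hP⟩ := h.nonempty
    let x := h.bot hP
    refine ⟨_, h.interval_mem P hP x x le_rfl, ?_⟩
    refine PosetClass.mk_eq_one (P := interval P x x) ⟨x, le_rfl, le_rfl⟩ ?_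
    rintro ⟨y, h₁, h₂⟩
    exact Subtype.ext (le_antisymm h₂ h₁)
  mul_mem' := by
    rintro _ _ ⟨P, hP, rfl⟩ ⟨Q, hQ, rfl⟩
    exact ⟨_, h.prod_mem P hP Q hQ, rfl⟩

/-- The class of a member of the family. -/
def IsHereditary.classOf (P : FinPartOrd.{0}) (hP : P ∈ 𝓟) : h.classes :=
  ⟨PosetClass.mk P, P, hP, rfl⟩

/-- The underlying algebra of the standard reduced incidence Hopf algebra of a hereditary family:
the vector space with basis the isomorphism classes of members of the family, with the product
induced by the direct product of posets. -/
def IncidenceAlg (K : Type u) [Field K] {𝓟 : Set FinPartOrd.{0}} (h : IsHereditary 𝓟) :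
    Type (max 1 u) :=
  MonoidAlgebra K h.classes

variable (K : Type u) [Field K]

instance : CommRing (IncidenceAlg K h) := inferInstanceAs (CommRing (MonoidAlgebra K h.classes))

instance : Algebra K (IncidenceAlg K h) :=
  inferInstanceAs (Algebra K (MonoidAlgebra K h.classes))

/-- The basis of the incidence Hopf algebra formed by the isomorphism classes. -/
def incidenceBasis : Module.Basis h.classes K (IncidenceAlg K h) :=
  MonoidAlgebra.basis h.classes K

/-- The basis element given by the class of a member `P` of the family. -/
def incidenceClass (P : FinPartOrd.{0}) (hP : P ∈ 𝓟) : IncidenceAlg K h :=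
  incidenceBasis h K (h.classOf P hP)

/-- The sum over `x ∈ P` of `[0_P, x] ⊗ [x, 1_P]`. -/
def incidenceSum (P : FinPartOrd.{0}) (hP : P ∈ 𝓟) :
    IncidenceAlg K h ⊗[K] IncidenceAlg K h :=
  ∑ x : P,
    incidenceClass h K (interval P (h.bot hP) x) (h.interval_mem P hP _ _ (h.bot_le hP x)) ⊗ₜ[K]
      incidenceClass h K (interval P x (h.top hP)) (h.interval_mem P hP _ _ (h.le_top hP x))

/-- The coproduct sends the class of `P` to the sum of the `[0_P, x] ⊗ [x, 1_P]`, and the counit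
sends the class of the one-point posets to `1` and every other class to `0`. The coproduct is
computed on a representative of the class; see `comul_incidenceClass` for the independence of the
choice. -/
instance : CoalgebraStruct K (IncidenceAlg K h) where
  comul := (incidenceBasis h K).constr K fun c =>
    incidenceSum h K c.2.choose c.2.choose_spec.1
  counit := (incidenceBasis h K).constr K fun c => by
    classical exact if c = 1 then 1 else 0

variable {h K}

theorem incidenceClass_congr {P Q : FinPartOrd.{0}} {hP : P ∈ 𝓟} {hQ : Q ∈ 𝓟}
    (e : P ≃o Q) : incidenceClass h K P hP = incidenceClass h K Q hQ := by
  have : h.classOf P hP = h.classOf Q hQ := Subtype.ext (PosetClass.mk_eq_mk.2 ⟨e⟩)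
  simp only [incidenceClass, this]

theorem interval_congr {P Q : FinPartOrd.{0}} (e : P ≃o Q) {x y : P} {x' y' : Q}
    (hx : e x = x') (hy : e y = y') : Nonempty (interval P x y ≃o interval Q x' y') := by
  subst hx hy
  exact ⟨{ toEquiv := e.toEquiv.subtypeEquiv fun a => by
              simp [Set.mem_Icc]
           map_rel_iff' := fun {a b} => e.map_rel_iff (a := a.1) (b := b.1) }⟩

theorem incidenceSum_congr {P Q : FinPartOrd.{0}} (hP : P ∈ 𝓟) (hQ : Q ∈ 𝓟) (e : P ≃o Q) :
    incidenceSum h K P hP = incidenceSum h K Q hQ := by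
  refine Fintype.sum_equiv e.toEquiv _ _ fun x => ?_
  have hb : e (h.bot hP) = h.bot hQ :=
    le_antisymm (by rw [← e.le_symm_apply]; exact h.bot_le hP _) (h.bot_le hQ _)
  have ht : e (h.top hP) = h.top hQ :=
    le_antisymm (h.le_top hQ _) (by rw [← e.symm_apply_le]; exact h.le_top hP _)
  obtain ⟨e₁⟩ := interval_congr e hb (rfl : e x = e x)
  obtain ⟨e₂⟩ := interval_congr e (rfl : e x = e x) ht
  congr 1
  · exact incidenceClass_congr e₁
  · exact incidenceClass_congr e₂

/-- The coproduct of the class of any member of the family. -/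
theorem comul_incidenceClass (P : FinPartOrd.{0}) (hP : P ∈ 𝓟) :
    CoalgebraStruct.comul (R := K) (incidenceClass h K P hP) = incidenceSum h K P hP := by
  change (incidenceBasis h K).constr K _ (incidenceBasis h K _) = _
  rw [Module.Basis.constr_basis]
  have hc := (h.classOf P hP).2
  obtain ⟨e⟩ := PosetClass.mk_eq_mk.1 hc.choose_spec.2
  exact incidenceSum_congr _ _ e

end Incidence

/-! ### Order ideals -/

/-- The poset `J(P)` of order ideals (initial segments) of `P`, ordered by inclusion. -/
def orderIdeals (P : FinPartOrd.{0}) : FinPartOrd.{0} :=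
  letI : Finite (LowerSet P) := Finite.of_injective (fun I : LowerSet P => (I : Set P))
    SetLike.coe_injective
  letI : Fintype (LowerSet P) := Fintype.ofFinite _
  FinPartOrd.of (LowerSet P)

/-- The family `J(ℱ)` of the posets isomorphic to `J(P)` for some `P` in `ℱ`. -/
def orderIdealFamily (ℱ : Set FinPartOrd.{0}) : Set FinPartOrd.{0} :=
  {L | ∃ P ∈ ℱ, Nonempty (L ≃o orderIdeals P)}

theorem orderIdeals_mem {ℱ : Set FinPartOrd.{0}} {P : FinPartOrd.{0}} (hP : P ∈ ℱ) :
    orderIdeals P ∈ orderIdealFamily ℱ :=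
  ⟨P, hP, ⟨OrderIso.refl _⟩⟩

/-! ### Rooted trees and rooted forests -/

/-- A rooted tree, as a finite oriented graph: the root has no incoming edge, every other vertex
has exactly one, and every vertex can be reached from the root. -/
structure TreeGraph where
  V : Type
  [finite : Finite V]
  Edge : V → V → Prop
  root : V
  not_edge_root : ∀ u, ¬ Edge u root
  existsUnique_edge : ∀ v, v ≠ root → ∃! u, Edge u v
  reach : ∀ v, Relation.ReflTransGen Edge root v

/-- A rooted forest, as a finite oriented graph: every vertex has at most one incoming edge, and
can be reached from a root, that is, from a vertex without incoming edges. Such a graph is the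
disjoint union of the rooted trees `ForestGraph.treeAt` spanned by its roots. -/
structure ForestGraph where
  V : Type
  [finite : Finite V]
  Edge : V → V → Prop
  edge_unique : ∀ {u u' v}, Edge u v → Edge u' v → u = u'
  reach : ∀ v, ∃ r, (∀ u, ¬ Edge u r) ∧ Relation.ReflTransGen Edge r v

attribute [instance] TreeGraph.finite ForestGraph.finite

namespace ForestGraph

variable (F : ForestGraph)

/-- Roots are the vertices without incoming edges. -/
def IsRoot (r : F.V) : Prop := ∀ u, ¬ F.Edge u r

theorem not_cycle (v : F.V) : ¬ Relation.TransGen F.Edge v v := by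
  obtain ⟨r, hr, hrv⟩ := F.reach v
  induction hrv with
  | refl =>
    intro hc
    obtain ⟨u, -, hu⟩ := (Relation.TransGen.tail'_iff).1 hc
    exact hr u hu
  | tail _ hbc ih =>
    intro hc
    obtain ⟨u, hcu, huc⟩ := (Relation.TransGen.tail'_iff).1 hc
    obtain rfl := F.edge_unique huc hbc
    exact ih (Relation.TransGen.head' hbc hcu)

/-- The partial order on the vertices: `x ≤ y` if and only if there is a path from a root to `y`
passing through `x`. -/
instance : PartialOrder F.V where
  le x y := ∃ r, F.IsRoot r ∧ Relation.ReflTransGen F.Edge r x ∧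
    Relation.ReflTransGen F.Edge x y
  le_refl x := by
    obtain ⟨r, hr, hrx⟩ := F.reach x
    exact ⟨r, hr, hrx, .refl⟩
  le_trans := by
    rintro x y z ⟨r, hr, hrx, hxy⟩ ⟨-, -, -, hyz⟩
    exact ⟨r, hr, hrx, hxy.trans hyz⟩
  le_antisymm := by
    rintro x y ⟨-, -, -, hxy⟩ ⟨-, -, -, hyx⟩
    rcases Relation.reflTransGen_iff_eq_or_transGen.1 hxy with h | h
    · exact h.symm
    · exact (F.not_cycle x (h.trans_left hyx)).elim

/-- The poset of vertices of a rooted forest. -/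
def poset : FinPartOrd.{0} :=
  letI : Fintype F.V := Fintype.ofFinite _
  FinPartOrd.of F.V

/-- The subforest supported on a set `W` of vertices: keep the edges which link two elements
of `W`. -/
def restrict (W : Set F.V) : ForestGraph where
  V := W
  Edge a b := F.Edge a b
  edge_unique ha hb := Subtype.ext (F.edge_unique ha hb)
  reach := by
    rintro ⟨v, hv⟩
    obtain ⟨r, hr, hrv⟩ := F.reach v
    induction hrv with
    | refl => exact ⟨⟨r, hv⟩, fun u => hr u, .refl⟩
    | @tail b c _ hbc ih =>
      by_cases hb : b ∈ W
      · obtain ⟨r', hr', h'⟩ := ih hb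
        exact ⟨r', hr', h'.tail hbc⟩
      · refine ⟨⟨c, hv⟩, fun u hu => hb ?_, .refl⟩
        rw [← F.edge_unique hu hbc]
        exact u.2

/-- The component of a rooted forest at a root `r`: the tree of all vertices that can be reached
from `r`. -/
def treeAt (r : F.V) (hr : F.IsRoot r) : TreeGraph where
  V := {v : F.V // Relation.ReflTransGen F.Edge r v}
  Edge a b := F.Edge a b
  root := ⟨r, .refl⟩
  not_edge_root u := hr u
  existsUnique_edge := by
    rintro ⟨v, hv⟩ hne
    rcases Relation.ReflTransGen.cases_tail hv with h | ⟨u, hu, huv⟩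
    · exact (hne (Subtype.ext h)).elim
    · exact ⟨⟨u, hu⟩, huv, fun w hw => Subtype.ext (F.edge_unique hw huv)⟩
  reach := by
    rintro ⟨v, hv⟩
    induction hv with
    | refl => exact .refl
    | tail hb hbc ih => exact ih.tail hbc

/-- The edges of a disjoint union of rooted trees. -/
inductive UnionEdge {ι : Type} (T : ι → TreeGraph) : (Σ i, (T i).V) → (Σ i, (T i).V) → Prop
  | mk (i : ι) (a b : (T i).V) : (T i).Edge a b → UnionEdge T ⟨i, a⟩ ⟨i, b⟩

/-- The disjoint union of a finite collection of rooted trees. -/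
def ofTrees {ι : Type} [Finite ι] (T : ι → TreeGraph) : ForestGraph where
  V := Σ i, (T i).V
  Edge := UnionEdge T
  edge_unique := by
    rintro _ _ _ ⟨i, a, b, hab⟩ ⟨_, a', _, hab'⟩
    have hb : b ≠ (T i).root := by
      rintro rfl
      exact (T i).not_edge_root _ hab
    rw [((T i).existsUnique_edge b hb).unique hab hab']
  reach := by
    rintro ⟨i, v⟩
    refine ⟨⟨i, (T i).root⟩, ?_, ?_⟩
    · rintro _ ⟨_, a, _, hab⟩
      exact (T i).not_edge_root _ hab
    · exact Relation.ReflTransGen.lift (fun a => (⟨i, a⟩ : Σ i, (T i).V))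
        (fun a b hab => UnionEdge.mk i a b hab) _ _ ((T i).reach v)

/-- The pair `(Wᶜ, W)` is an admissible cut: `y < x` for any comparable `x ∉ W` and `y ∈ W`. -/
def IsAdmissibleCut (W : Set F.V) : Prop :=
  ∀ x ∉ W, ∀ y ∈ W, x ≤ y ∨ y ≤ x → y < x

end ForestGraph

/-- The poset of vertices of a rooted tree: `x ≤ y` if and only if there is a path from the root
to `y` passing through `x`. -/
def TreeGraph.poset (T : TreeGraph) : FinPartOrd.{0} :=
  (ForestGraph.mk T.V T.Edge
    (fun {u u' v} hu hu' => by
      have hv : v ≠ T.root := by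
        rintro rfl
        exact T.not_edge_root _ hu
      exact (T.existsUnique_edge v hv).unique hu hu')
    (fun v => ⟨T.root, T.not_edge_root, T.reach v⟩)).poset

/-- Two graphs define the same rooted tree if and only if their posets are isomorphic. -/
instance treeSetoid : Setoid TreeGraph where
  r T T' := Nonempty (T.poset ≃o T'.poset)
  iseqv :=
    ⟨fun _ => ⟨OrderIso.refl _⟩, fun ⟨e⟩ => ⟨e.symm⟩, fun ⟨e⟩ ⟨f⟩ => ⟨e.trans f⟩⟩

/-- (Nonempty) rooted trees. -/
def RootedTree : Type 1 := Quotient treeSetoid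

/-- The family of rooted forests, viewed as posets. -/
def rootedForests : Set FinPartOrd.{0} := {P | ∃ F : ForestGraph, Nonempty (P ≃o F.poset)}

theorem ForestGraph.poset_mem (F : ForestGraph) : F.poset ∈ rootedForests :=
  ⟨F, ⟨OrderIso.refl _⟩⟩

/-- The disjoint union of two finite posets, elements of different summands being
incomparable. -/
def disjUnion (P Q : FinPartOrd.{0}) : FinPartOrd.{0} := FinPartOrd.of (P ⊕ Q)

open Classical in
/-- A subset of a finite poset, with the induced order. -/
def subposet (P : FinPartOrd.{0}) (s : Set P) : FinPartOrd.{0} := FinPartOrd.of s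

/-! ### The Hopf algebra of rooted trees -/

section HRT

variable (K : Type u) [Field K]

/-- The free commutative unital algebra generated by rooted trees. -/
def HRT : Type (max 1 u) := MvPolynomial RootedTree K

instance : CommRing (HRT K) := inferInstanceAs (CommRing (MvPolynomial RootedTree K))

instance : Algebra K (HRT K) := inferInstanceAs (Algebra K (MvPolynomial RootedTree K))

/-- The generator given by a rooted tree. -/
def treeGen (t : RootedTree) : HRT K := (MvPolynomial.X t : MvPolynomial RootedTree K)

/-- A rooted forest as an element of the algebra: the product of its trees. -/
def forestElt (F : ForestGraph) : HRT K :=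
  letI : Fintype {r : F.V // F.IsRoot r} := Fintype.ofFinite _
  ∏ r : {r : F.V // F.IsRoot r}, treeGen K (Quotient.mk treeSetoid (F.treeAt r.1 r.2))

open Classical in
/-- The sum of `crown ⊗ trunk` over the admissible cuts of a rooted forest. -/
def cutSum (F : ForestGraph) : HRT K ⊗[K] HRT K :=
  letI : Fintype F.V := Fintype.ofFinite _
  ∑ W : {W : Set F.V // F.IsAdmissibleCut W},
    forestElt K (F.restrict W.1ᶜ) ⊗ₜ[K] forestElt K (F.restrict W.1)

/-- A rooted forest representing the monomial `m` in rooted trees: it consists of `m t` copies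
of a representative of `t`, for each rooted tree `t`. -/
def monomialForest (m : RootedTree →₀ ℕ) : ForestGraph :=
  ForestGraph.ofTrees fun i : Fin m.toMultiset.toList.length => (m.toMultiset.toList.get i).out

/-- The coproduct of a rooted forest is the sum over its admissible cuts of
`crown ⊗ trunk`, and the counit sends the empty forest to `1` and every other forest to `0`.
The forests are the basis of monomials in rooted trees; the cuts are computed on a
representative. -/
instance : CoalgebraStruct K (HRT K) where
  comul := (MvPolynomial.basisMonomials RootedTree K).constr K fun m =>
    cutSum K (monomialForest m)
  counit := (MvPolynomial.basisMonomials RootedTree K).constr K fun m => by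
    classical exact if m = 0 then 1 else 0

end HRT

end IncHopf

end

open IncHopf

noncomputable section

namespace IncHopf

universe u

/-! ### The antipode of a commutative Hopf algebra -/

section Antipode

open WithConv HopfAlgebra

variable {K A : Type*} [CommSemiring K] [CommSemiring A] [HopfAlgebra K A]

/-! Order ideals translate forests into incidence algebras. An interval `[I, J]` of `J(P)` is `J(J \
I)` (`iccLowerSet`), and `J` turns disjoint unions into products (`orderIdealsDisjUnion`). Since
forests are closed under disjoint unions and convex subsets, `J(ℱ)` is hereditary. Any hereditary
family gives a Hopf algebra (`isHopf_incidence`): its coproduct behaves like matrix multiplication,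
and the identity is convolution invertible because the unit minus the identity is locally nilpotent.

By Birkhoff, `P` is recovered from `J(P)` as the poset of sup-irreducible elements
(`nonempty_orderIso_of_orderIdeals`). Hence the classes in `J(ℱ)` correspond to isomorphism classes
of forests, that is, to multisets of trees, that is, to monomials. Sending a forest `F` to the class
of `J(F)` is therefore multiplicative and matches two bases (`bijective_ofForests`).

An admissible cut amounts to choosing an order ideal `I` as trunk. The incidence coproduct has
`J(I)`, the trunk, on the left, whereas the cut coproduct has the crown there; this is the flip
(`map_toForests_comul_idealsClass`). The antipode of a commutative Hopf algebra is an involutive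
algebra automorphism which reverses the coproduct, so composing with it cancels the flip
(`exists_hopfIso`). The Hopf axioms then pass to the algebra of trees along this isomorphism
(`IsHopf.of_algEquiv`). -/

theorem antipode_antipode_apply (a : A) : antipode K (antipode K a) = a := by
  -- Algebra maps out of `A` into a commutative algebra form a group under convolution, in which the
  -- inverse of `f` is `f` composed with the antipode.
  have h : (toConv (AlgHom.id K A))⁻¹⁻¹ = toConv (AlgHom.id K A) := inv_inv _
  exact congr($h a)

/-- In the convolution group of algebra maps from `A` to `A ⊗ A`, the coproduct is the product of
the two inclusions. Inversion composes each map with the antipode and reverses the product, which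
swaps the tensor factors. -/
theorem comul_antipode_apply (a : A) :
    Coalgebra.comul (R := K) (antipode K a) = TensorProduct.comm K A A
      (TensorProduct.map (antipode K) (antipode K) (Coalgebra.comul (R := K) a)) := by
  let i₁ : WithConv (A →ₐ[K] A ⊗[K] A) := toConv Algebra.TensorProduct.includeLeft
  let i₂ : WithConv (A →ₐ[K] A ⊗[K] A) := toConv Algebra.TensorProduct.includeRight
  have key : i₁ * i₂ = toConv (Bialgebra.comulAlgHom K A) := by
    rw [AlgHom.convMul_def]
    congr 1
    have : (Algebra.TensorProduct.lmul' K).comp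
        (Algebra.TensorProduct.map i₁.ofConv i₂.ofConv) = AlgHom.id K (A ⊗[K] A) := by
      ext <;> simp [i₁, i₂]
    rw [← AlgHom.comp_assoc, this, AlgHom.id_comp]
  have h : (i₁ * i₂)⁻¹ = i₂⁻¹ * i₁⁻¹ := @mul_inv_rev (WithConv (A →ₐ[K] A ⊗[K] A)) _ i₁ i₂
  rw [key] at h
  have h' := congr($h a)
  refine Eq.trans h' ?_
  rw [AlgHom.convMul_apply]
  induction Coalgebra.comul (R := K) a with
  | zero => simp
  | add x y hx hy => simp only [map_add, hx, hy]
  | tmul x y =>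
    change (1 ⊗ₜ[K] antipode K x) * (antipode K y ⊗ₜ[K] 1) = antipode K y ⊗ₜ[K] antipode K x
    simp

end Antipode

/-! ### Reversing the coproduct, and transport of the Hopf axioms -/

section Transport

variable {K A B : Type*} [CommSemiring K] [CommSemiring A] [Algebra K A] [CoalgebraStruct K A]
  [CommSemiring B] [Algebra K B] [CoalgebraStruct K B]

/-- A commutative Hopf algebra has an automorphism which reverses the coproduct. -/
theorem IsHopf.exists_flip (h : IsHopf K A) : ∃ S : A ≃ₐ[K] A,
    (∀ a, CoalgebraStruct.comul (R := K) (S a) = TensorProduct.comm K A A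
      (TensorProduct.map S.toLinearMap S.toLinearMap (CoalgebraStruct.comul (R := K) a))) ∧
    ∀ a, CoalgebraStruct.counit (R := K) (S a) = CoalgebraStruct.counit (R := K) a := by
  let := h.toHopfAlgebra
  exact ⟨AlgEquiv.ofAlgHom (HopfAlgebra.antipodeAlgHom K A) (HopfAlgebra.antipodeAlgHom K A)
      (AlgHom.ext antipode_antipode_apply) (AlgHom.ext antipode_antipode_apply),
    comul_antipode_apply, HopfAlgebra.counit_antipode⟩

/-- Being a Hopf algebra is preserved under isomorphism. -/
theorem IsHopf.of_algEquiv (h : IsHopf K A) (f : A ≃ₐ[K] B)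
    (hf : ∀ a, CoalgebraStruct.comul (R := K) (f a) =
      TensorProduct.map f.toLinearMap f.toLinearMap (CoalgebraStruct.comul (R := K) a))
    (hf' : ∀ a, CoalgebraStruct.counit (R := K) (f a) = CoalgebraStruct.counit (R := K) a) :
    IsHopf K B := by
  have hmap : ∀ x : A ⊗[K] A, TensorProduct.map f.toLinearMap f.toLinearMap x =
      Algebra.TensorProduct.map f.toAlgHom f.toAlgHom x := fun _ => rfl
  refine ⟨?_, ?_, ?_, ?_, ?_, ?_, ?_, ?_⟩
  -- For each axiom, `key` says that `f` intertwines the operation involved; both sides being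
  -- additive, pure tensors suffice.
  · have key : ∀ x : A ⊗[K] A, TensorProduct.assoc K B B B
        (CoalgebraStruct.comul.rTensor B (TensorProduct.map f.toLinearMap f.toLinearMap x)) =
        TensorProduct.map f.toLinearMap (TensorProduct.map f.toLinearMap f.toLinearMap)
          (TensorProduct.assoc K A A A (CoalgebraStruct.comul.rTensor A x)) := by
      intro x
      induction x with
      | zero => simp
      | add x y hx hy => simp only [map_add, hx, hy]
      | tmul x y =>
        simp only [TensorProduct.map_tmul, AlgEquiv.toLinearMap_apply, LinearMap.rTensor_tmul, hf]
        induction CoalgebraStruct.comul (R := K) x with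
        | zero => simp
        | add x y hx hy => simp only [map_add, TensorProduct.add_tmul, hx, hy]
        | tmul x y => simp
    have key' : ∀ x : A ⊗[K] A,
        CoalgebraStruct.comul.lTensor B (TensorProduct.map f.toLinearMap f.toLinearMap x) =
        TensorProduct.map f.toLinearMap (TensorProduct.map f.toLinearMap f.toLinearMap)
          (CoalgebraStruct.comul.lTensor A x) := by
      intro x
      induction x with
      | zero => simp
      | add x y hx hy => simp only [map_add, hx, hy]
      | tmul x y => simp [hf]
    ext b
    obtain ⟨a, rfl⟩ := f.surjective b
    have := congr($(h.coassoc) a)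
    simp only [LinearMap.comp_apply, LinearEquiv.coe_coe] at this ⊢
    rw [hf, key, key', this]
  · have key : ∀ x : A ⊗[K] A,
        CoalgebraStruct.counit.rTensor B (TensorProduct.map f.toLinearMap f.toLinearMap x) =
        TensorProduct.map LinearMap.id f.toLinearMap (CoalgebraStruct.counit.rTensor A x) := by
      intro x
      induction x with
      | zero => simp
      | add x y hx hy => simp only [map_add, hx, hy]
      | tmul x y => simp [hf']
    ext b
    obtain ⟨a, rfl⟩ := f.surjective b
    have := congr($(h.rTensor_counit) a)
    simp only [LinearMap.comp_apply] at this ⊢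
    rw [hf, key, this]
    simp
  · have key : ∀ x : A ⊗[K] A,
        CoalgebraStruct.counit.lTensor B (TensorProduct.map f.toLinearMap f.toLinearMap x) =
        TensorProduct.map f.toLinearMap LinearMap.id (CoalgebraStruct.counit.lTensor A x) := by
      intro x
      induction x with
      | zero => simp
      | add x y hx hy => simp only [map_add, hx, hy]
      | tmul x y => simp [hf']
    ext b
    obtain ⟨a, rfl⟩ := f.surjective b
    have := congr($(h.lTensor_counit) a)
    simp only [LinearMap.comp_apply] at this ⊢
    rw [hf, key, this]
    simp
  · rw [← map_one f, hf', h.counit_one]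
  · intro a b
    obtain ⟨a, rfl⟩ := f.surjective a
    obtain ⟨b, rfl⟩ := f.surjective b
    rw [← map_mul, hf', hf', hf', h.counit_mul]
  · rw [← map_one f, hf, h.comul_one, hmap, map_one]
  · intro a b
    obtain ⟨a, rfl⟩ := f.surjective a
    obtain ⟨b, rfl⟩ := f.surjective b
    rw [← map_mul, hf, hf, hf, h.comul_mul, hmap, map_mul, hmap, hmap]
  · obtain ⟨S, h₁, h₂⟩ := h.exists_antipode
    -- The antipode of `A` conjugated by `f`.
    let T : B →ₗ[K] B := f.toLinearMap ∘ₗ S ∘ₗ f.symm.toLinearMap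
    have key : ∀ x : A ⊗[K] A,
        LinearMap.mul' K B (T.rTensor B (TensorProduct.map f.toLinearMap f.toLinearMap x)) =
        f (LinearMap.mul' K A (S.rTensor A x)) := by
      intro x
      induction x with
      | zero => simp
      | add x y hx hy => simp only [map_add, hx, hy]
      | tmul x y => simp [T]
    have key' : ∀ x : A ⊗[K] A,
        LinearMap.mul' K B (T.lTensor B (TensorProduct.map f.toLinearMap f.toLinearMap x)) =
        f (LinearMap.mul' K A (S.lTensor A x)) := by
      intro x
      induction x with
      | zero => simp
      | add x y hx hy => simp only [map_add, hx, hy]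
      | tmul x y => simp [T]
    refine ⟨T, ?_, ?_⟩
    · ext b
      obtain ⟨a, rfl⟩ := f.surjective b
      have := congr($h₁ a)
      simp only [LinearMap.comp_apply] at this ⊢
      rw [hf, hf', key, this]
      simp
    · ext b
      obtain ⟨a, rfl⟩ := f.surjective b
      have := congr($h₂ a)
      simp only [LinearMap.comp_apply] at this ⊢
      rw [hf, hf', key', this]
      simp

end Transport

/-! ### Incidence Hopf algebras -/

section IncidenceHopf

variable {𝓟 : Set FinPartOrd.{0}} {h : IsHereditary 𝓟} {K : Type u} [Field K]

theorem incidenceClass_eq_basis (P : FinPartOrd.{0}) (hP : P ∈ 𝓟) :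
    incidenceClass h K P hP = incidenceBasis h K (h.classOf P hP) := rfl

theorem incidence_linearMap_ext {M : Type*} [AddCommMonoid M] [Module K M]
    {f g : IncidenceAlg K h →ₗ[K] M}
    (hfg : ∀ P hP, f (incidenceClass h K P hP) = g (incidenceClass h K P hP)) : f = g := by
  refine (incidenceBasis h K).ext ?_
  rintro ⟨_, P, hP, rfl⟩
  exact hfg P hP

theorem incidenceBasis_one : incidenceBasis h K 1 = 1 := rfl

theorem incidenceBasis_mul (a b : h.classes) :
    incidenceBasis h K (a * b) = incidenceBasis h K a * incidenceBasis h K b := by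
  have := (MonoidAlgebra.single_mul_single a b (1 : K) 1).symm
  rw [one_mul] at this
  exact this

theorem incidenceClass_mul (P Q : FinPartOrd.{0}) (hP : P ∈ 𝓟) (hQ : Q ∈ 𝓟) :
    incidenceClass h K P hP * incidenceClass h K Q hQ =
      incidenceClass h K (FinPartOrd.of (P × Q)) (h.prod_mem P hP Q hQ) :=
  (incidenceBasis_mul _ _).symm

theorem incidenceClass_eq_one {P : FinPartOrd.{0}} {hP : P ∈ 𝓟} (x : P) (hx : ∀ y : P, y = x) :
    incidenceClass h K P hP = 1 := by
  have : h.classOf P hP = 1 := Subtype.ext (PosetClass.mk_eq_one x hx)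
  rw [incidenceClass_eq_basis, this, incidenceBasis_one]

theorem counit_incidenceBasis (c : h.classes) [Decidable (c = 1)] :
    CoalgebraStruct.counit (R := K) (incidenceBasis h K c) = if c = 1 then 1 else 0 := by
  change (incidenceBasis h K).constr K _ (incidenceBasis h K _) = _
  rw [Module.Basis.constr_basis]
  congr

open Classical in
/-- The class of the interval `[x, y]`, or `0` if `x ≤ y` does not hold. -/
def intervalClass (h : IsHereditary 𝓟) (K : Type u) [Field K] {P : FinPartOrd.{0}} (hP : P ∈ 𝓟)
    (x y : P) : IncidenceAlg K h :=
  if hxy : x ≤ y then incidenceClass h K (interval P x y) (h.interval_mem P hP x y hxy) else 0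

theorem intervalClass_of_le {P : FinPartOrd.{0}} (hP : P ∈ 𝓟) {x y : P} (hxy : x ≤ y) :
    intervalClass h K hP x y =
      incidenceClass h K (interval P x y) (h.interval_mem P hP x y hxy) := dif_pos hxy

theorem intervalClass_of_not_le {P : FinPartOrd.{0}} (hP : P ∈ 𝓟) {x y : P} (hxy : ¬ x ≤ y) :
    intervalClass h K hP x y = 0 := dif_neg hxy

theorem intervalClass_self {P : FinPartOrd.{0}} (hP : P ∈ 𝓟) (x : P) :
    intervalClass h K hP x x = 1 := by
  rw [intervalClass_of_le hP le_rfl]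
  refine incidenceClass_eq_one (P := interval P x x) ⟨x, le_rfl, le_rfl⟩ ?_
  rintro ⟨y, h₁, h₂⟩
  exact Subtype.ext (le_antisymm h₂ h₁)

theorem intervalClass_bot_top {P : FinPartOrd.{0}} (hP : P ∈ 𝓟) :
    intervalClass h K hP (h.bot hP) (h.top hP) = incidenceClass h K P hP := by
  rw [intervalClass_of_le hP (h.bot_le hP _)]
  exact incidenceClass_congr
    { toFun := fun x => x.1
      invFun := fun x => ⟨x, h.bot_le hP x, h.le_top hP x⟩
      left_inv := fun _ => rfl
      right_inv := fun _ => rfl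
      map_rel_iff' := Iff.rfl }

/-- The least element of an interval. -/
def intervalBot {P : FinPartOrd.{0}} {x y : P} (hxy : x ≤ y) : interval P x y :=
  ⟨x, le_rfl, hxy⟩

/-- The greatest element of an interval. -/
def intervalTop {P : FinPartOrd.{0}} {x y : P} (hxy : x ≤ y) : interval P x y :=
  ⟨y, hxy, le_rfl⟩

theorem isBot_intervalBot {P : FinPartOrd.{0}} {x y : P} (hxy : x ≤ y) :
    IsBot (intervalBot hxy) := fun z => z.2.1

theorem isTop_intervalTop {P : FinPartOrd.{0}} {x y : P} (hxy : x ≤ y) :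
    IsTop (intervalTop hxy) := fun z => z.2.2

/-- An interval in an interval is an interval. -/
def intervalInterval {P : FinPartOrd.{0}} {x y : P} (a b : interval P x y) :
    interval (interval P x y) a b ≃o interval P a.1 b.1 where
  toFun z := ⟨z.1.1, z.2.1, z.2.2⟩
  invFun z := ⟨⟨z.1, a.2.1.trans z.2.1, z.2.2.trans b.2.2⟩, z.2.1, z.2.2⟩
  left_inv _ := rfl
  right_inv _ := rfl
  map_rel_iff' := Iff.rfl

/-- An interval in a direct product is the direct product of intervals. -/
def intervalProd {P Q : FinPartOrd.{0}} (x y : P) (x' y' : Q) :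
    FinPartOrd.of (interval P x y × interval Q x' y') ≃o
      interval (FinPartOrd.of (P × Q)) (x, x') (y, y') where
  toFun z := ⟨(z.1.1, z.2.1), ⟨z.1.2.1, z.2.2.1⟩, ⟨z.1.2.2, z.2.2.2⟩⟩
  invFun z := (⟨z.1.1, z.2.1.1, z.2.2.1⟩, ⟨z.1.2, z.2.1.2, z.2.2.2⟩)
  left_inv _ := rfl
  right_inv _ := rfl
  map_rel_iff' := Iff.rfl

theorem intervalClass_interval {P : FinPartOrd.{0}} (hP : P ∈ 𝓟) {x y : P} (hxy : x ≤ y)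
    (a b : interval P x y) :
    intervalClass h K (h.interval_mem P hP x y hxy) a b = intervalClass h K hP a.1 b.1 := by
  by_cases hab : a ≤ b
  · rw [intervalClass_of_le _ hab, intervalClass_of_le hP (show a.1 ≤ b.1 from hab)]
    exact incidenceClass_congr (intervalInterval a b)
  · rw [intervalClass_of_not_le _ hab, intervalClass_of_not_le hP (show ¬ a.1 ≤ b.1 from hab)]

theorem intervalClass_mul {P Q : FinPartOrd.{0}} (hP : P ∈ 𝓟) (hQ : Q ∈ 𝓟) (x y : P) (x' y' : Q) :
    intervalClass h K hP x y * intervalClass h K hQ x' y' =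
      intervalClass h K (h.prod_mem P hP Q hQ) (x, x') (y, y') := by
  by_cases hxy : x ≤ y
  · by_cases hxy' : x' ≤ y'
    · rw [intervalClass_of_le hP hxy, intervalClass_of_le hQ hxy', incidenceClass_mul,
        intervalClass_of_le _ (show ((x, x') : FinPartOrd.of (P × Q)) ≤ (y, y') from ⟨hxy, hxy'⟩)]
      exact incidenceClass_congr (intervalProd x y x' y')
    · rw [intervalClass_of_not_le hQ hxy', mul_zero, intervalClass_of_not_le]
      exact fun hh => hxy' hh.2
  · rw [intervalClass_of_not_le hP hxy, zero_mul, intervalClass_of_not_le]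
    exact fun hh => hxy hh.1

theorem incidenceSum_eq {P : FinPartOrd.{0}} (hP : P ∈ 𝓟) {b t : P} (hb : IsBot b) (ht : IsTop t) :
    incidenceSum h K P hP =
      ∑ x : P, intervalClass h K hP b x ⊗ₜ[K] intervalClass h K hP x t := by
  obtain rfl : b = h.bot hP := le_antisymm (hb _) (h.bot_le hP _)
  obtain rfl : t = h.top hP := le_antisymm (h.le_top hP _) (ht _)
  refine Finset.sum_congr rfl fun x _ => ?_
  rw [intervalClass_of_le hP (h.bot_le hP x), intervalClass_of_le hP (h.le_top hP x)]

/-- Extending interval classes by zero lets `z` range over all of `P`, whether or not `x ≤ y`. The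
formula then has the shape of a matrix product, and coassociativity is an exchange of two finite
sums. -/
theorem comul_intervalClass {P : FinPartOrd.{0}} (hP : P ∈ 𝓟) (x y : P) :
    CoalgebraStruct.comul (R := K) (intervalClass h K hP x y) =
      ∑ z : P, intervalClass h K hP x z ⊗ₜ[K] intervalClass h K hP z y := by
  classical
  by_cases hxy : x ≤ y
  · rw [intervalClass_of_le hP hxy, comul_incidenceClass,
      incidenceSum_eq _ (isBot_intervalBot hxy) (isTop_intervalTop hxy)]
    refine Finset.sum_of_injOn (fun z : interval P x y => z.1) Subtype.val_injective.injOn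
      (fun _ _ => Finset.mem_coe.2 (Finset.mem_univ _)) (fun z _ hz => ?_)
      (fun z _ => congrArg₂ _ (intervalClass_interval hP hxy _ z)
        (intervalClass_interval hP hxy z _))
    by_cases hxz : x ≤ z
    · by_cases hzy : z ≤ y
      · exact (hz ⟨⟨z, hxz, hzy⟩, Finset.mem_coe.2 (Finset.mem_univ _), rfl⟩).elim
      · rw [intervalClass_of_not_le hP hzy, TensorProduct.tmul_zero]
    · rw [intervalClass_of_not_le hP hxz, TensorProduct.zero_tmul]
  · rw [intervalClass_of_not_le hP hxy, map_zero, eq_comm]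
    refine Finset.sum_eq_zero fun z _ => ?_
    by_cases hxz : x ≤ z
    · rw [intervalClass_of_not_le hP (y := y) (fun hzy => hxy (hxz.trans hzy)),
        TensorProduct.tmul_zero]
    · rw [intervalClass_of_not_le hP hxz, TensorProduct.zero_tmul]

theorem counit_intervalClass {P : FinPartOrd.{0}} (hP : P ∈ 𝓟) (x y : P) [Decidable (x = y)] :
    CoalgebraStruct.counit (R := K) (intervalClass h K hP x y) = if x = y then 1 else 0 := by
  classical
  split_ifs with hxy
  · subst hxy
    rw [intervalClass_self, ← incidenceBasis_one, counit_incidenceBasis, if_pos rfl]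
  · by_cases hle : x ≤ y
    · rw [intervalClass_of_le hP hle, incidenceClass_eq_basis, counit_incidenceBasis, if_neg]
      intro h1
      obtain ⟨e⟩ := PosetClass.mk_eq_mk.1 (Subtype.ext_iff.1 h1)
      have : (⟨x, le_rfl, hle⟩ : Set.Icc x y) = ⟨y, hle, le_rfl⟩ :=
        e.injective (Subsingleton.elim (α := PUnit) _ _)
      exact hxy (congrArg Subtype.val this)
    · rw [intervalClass_of_not_le hP hle, map_zero]

/-! ### Coalgebra axioms and compatibility with the product -/

theorem incidence_coassoc :
    (TensorProduct.assoc K (IncidenceAlg K h) (IncidenceAlg K h) (IncidenceAlg K h)).toLinearMap ∘ₗ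
      (CoalgebraStruct.comul (R := K) (A := IncidenceAlg K h)).rTensor _ ∘ₗ
        CoalgebraStruct.comul =
    (CoalgebraStruct.comul (R := K) (A := IncidenceAlg K h)).lTensor _ ∘ₗ
      CoalgebraStruct.comul := by
  refine incidence_linearMap_ext fun P hP => ?_
  rw [← intervalClass_bot_top]
  simp only [LinearMap.comp_apply, comul_intervalClass, map_sum, LinearMap.rTensor_tmul,
    LinearMap.lTensor_tmul, TensorProduct.sum_tmul, TensorProduct.tmul_sum, LinearEquiv.coe_coe,
    TensorProduct.assoc_tmul]
  exact Finset.sum_comm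

theorem incidence_rTensor_counit :
    (CoalgebraStruct.counit (R := K) (A := IncidenceAlg K h)).rTensor _ ∘ₗ CoalgebraStruct.comul =
      TensorProduct.mk K K _ 1 := by
  classical
  refine incidence_linearMap_ext fun P hP => ?_
  rw [← intervalClass_bot_top]
  simp only [LinearMap.comp_apply, comul_intervalClass, map_sum, LinearMap.rTensor_tmul,
    counit_intervalClass]
  rw [Finset.sum_eq_single (h.bot hP)]
  · simp
  · intro z _ hz
    rw [if_neg hz.symm, TensorProduct.zero_tmul]
  · simp

theorem incidence_lTensor_counit :
    (CoalgebraStruct.counit (R := K) (A := IncidenceAlg K h)).lTensor _ ∘ₗ CoalgebraStruct.comul =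
      (TensorProduct.mk K _ K).flip 1 := by
  classical
  refine incidence_linearMap_ext fun P hP => ?_
  rw [← intervalClass_bot_top]
  simp only [LinearMap.comp_apply, comul_intervalClass, map_sum, LinearMap.lTensor_tmul,
    counit_intervalClass]
  rw [Finset.sum_eq_single (h.top hP)]
  · simp
  · intro z _ hz
    rw [if_neg hz, TensorProduct.tmul_zero]
  · simp

theorem incidence_counit_one : CoalgebraStruct.counit (R := K) (1 : IncidenceAlg K h) = 1 := by
  classical
  rw [← incidenceBasis_one, counit_incidenceBasis, if_pos rfl]

theorem incidence_counit_mul (a b : IncidenceAlg K h) :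
    CoalgebraStruct.counit (R := K) (a * b) =
      CoalgebraStruct.counit (R := K) a * CoalgebraStruct.counit (R := K) b := by
  classical
  have : (LinearMap.mul K (IncidenceAlg K h)).compr₂ (CoalgebraStruct.counit (R := K)) =
      (LinearMap.mul K K).compl₁₂ CoalgebraStruct.counit CoalgebraStruct.counit := by
    refine incidence_linearMap_ext fun P hP => incidence_linearMap_ext fun Q hQ => ?_
    rw [← intervalClass_bot_top, ← intervalClass_bot_top]
    simp only [LinearMap.compr₂_apply, LinearMap.mul_apply', intervalClass_mul,
      counit_intervalClass, LinearMap.compl₁₂_apply]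
    by_cases hb : h.bot hP = h.top hP <;> by_cases hb' : h.bot hQ = h.top hQ <;>
      simp [hb, hb', Prod.ext_iff]
  exact congr($this a b)

theorem incidence_comul_one : CoalgebraStruct.comul (R := K) (1 : IncidenceAlg K h) = 1 := by
  obtain ⟨P, hP⟩ := h.nonempty
  let x := h.bot hP
  -- The unit is represented by the one-point interval `[x, x]`; only `z = x` contributes to its
  -- coproduct.
  rw [← intervalClass_self (K := K) (h := h) hP x, comul_intervalClass, Finset.sum_eq_single x]
  · rw [intervalClass_self, Algebra.TensorProduct.one_def]
  · intro y _ hy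
    by_cases hxy : x ≤ y
    · rw [intervalClass_of_not_le hP (fun hyx => hy (le_antisymm hyx hxy)),
        TensorProduct.tmul_zero]
    · rw [intervalClass_of_not_le hP hxy, TensorProduct.zero_tmul]
  · exact fun hh => (hh (Finset.mem_univ _)).elim

theorem incidence_comul_mul (a b : IncidenceAlg K h) :
    CoalgebraStruct.comul (R := K) (a * b) =
      CoalgebraStruct.comul (R := K) a * CoalgebraStruct.comul (R := K) b := by
  have : (LinearMap.mul K (IncidenceAlg K h)).compr₂ (CoalgebraStruct.comul (R := K)) =
      (LinearMap.mul K (IncidenceAlg K h ⊗[K] IncidenceAlg K h)).compl₁₂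
        CoalgebraStruct.comul CoalgebraStruct.comul := by
    refine incidence_linearMap_ext fun P hP => incidence_linearMap_ext fun Q hQ => ?_
    rw [← intervalClass_bot_top, ← intervalClass_bot_top]
    simp only [LinearMap.compr₂_apply, LinearMap.mul_apply', intervalClass_mul,
      comul_intervalClass, LinearMap.compl₁₂_apply]
    rw [Finset.sum_mul_sum, ← Finset.sum_product']
    refine Finset.sum_congr rfl fun z _ => ?_
    rw [Algebra.TensorProduct.tmul_mul_tmul, intervalClass_mul, intervalClass_mul]
  exact congr($this a b)

variable (h K) in
/-- The coalgebra structure of the incidence Hopf algebra. -/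
abbrev incidenceCoalgebra : Coalgebra K (IncidenceAlg K h) where
  coassoc := incidence_coassoc
  rTensor_counit_comp_comul := incidence_rTensor_counit
  lTensor_counit_comp_comul := incidence_lTensor_counit

/-! ### Existence of the antipode -/

theorem card_interval_le {P : FinPartOrd.{0}} (x y : P) :
    Fintype.card (interval P x y) ≤ Fintype.card P :=
  Fintype.card_le_of_injective (fun z : interval P x y => z.1) Subtype.val_injective

theorem card_interval_lt {P : FinPartOrd.{0}} {x y z : P} (hyz : y < z) :
    Fintype.card (interval P x y) < Fintype.card P :=
  Fintype.card_lt_of_injective_of_notMem (fun z : interval P x y => z.1) Subtype.val_injective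
    (b := z) (by rintro ⟨w, rfl⟩; exact hyz.not_ge w.2.2)

-- The antipode is the geometric series of `u`, the convolution unit minus the identity. As `u`
-- kills one-point classes, `u ^ n` only sees strict chains of `n` steps, so the series is finite on
-- each poset.
open WithConv in
theorem exists_antipode_incidence : ∃ S : IncidenceAlg K h →ₗ[K] IncidenceAlg K h,
    LinearMap.mul' K _ ∘ₗ S.rTensor _ ∘ₗ CoalgebraStruct.comul =
        Algebra.linearMap K (IncidenceAlg K h) ∘ₗ CoalgebraStruct.counit ∧
      LinearMap.mul' K _ ∘ₗ S.lTensor _ ∘ₗ CoalgebraStruct.comul =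
        Algebra.linearMap K (IncidenceAlg K h) ∘ₗ CoalgebraStruct.counit := by
  classical
  let := incidenceCoalgebra h K
  let u : WithConv (IncidenceAlg K h →ₗ[K] IncidenceAlg K h) := 1 - toConv LinearMap.id
  have mul_apply (f g : WithConv (IncidenceAlg K h →ₗ[K] IncidenceAlg K h)) {P : FinPartOrd.{0}}
      (hP : P ∈ 𝓟) : (f * g) (incidenceClass h K P hP) =
        ∑ x : P, f (intervalClass h K hP (h.bot hP) x) * g (intervalClass h K hP x (h.top hP)) := by
    rw [LinearMap.convMul_apply, ← intervalClass_bot_top]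
    have := comul_intervalClass (K := K) (h := h) hP (h.bot hP) (h.top hP)
    refine (congrArg _ (congrArg _ this)).trans ?_
    simp only [map_sum, TensorProduct.map_tmul, LinearMap.mul'_apply]
  have hu_one : u 1 = 0 := by
    change algebraMap K (IncidenceAlg K h) (CoalgebraStruct.counit 1) - 1 = 0
    rw [incidence_counit_one, map_one, sub_self]
  -- The case `n = 0` is vacuous since `P` contains its least element. In the other case, the term
  -- of the greatest element has the factor `u 1 = 0`, and for any other `x` the interval from the
  -- least element to `x` has fewer elements than `P`.
  have hu (n : ℕ) : ∀ (P : FinPartOrd.{0}) (hP : P ∈ 𝓟), Fintype.card P ≤ n →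
      (u ^ n) (incidenceClass h K P hP) = 0 := by
    induction n with
    | zero =>
      intro P hP hn
      exact absurd (Fintype.card_pos_iff.2 ⟨h.bot hP⟩) (by omega)
    | succ n ih =>
      intro P hP hn
      rw [pow_succ, mul_apply]
      refine Finset.sum_eq_zero fun x _ => ?_
      by_cases hx : x = h.top hP
      · rw [hx, intervalClass_self, hu_one, mul_zero]
      · rw [intervalClass_of_le hP (h.bot_le hP x), ih, zero_mul]
        have := card_interval_lt (x := h.bot hP) (lt_of_le_of_ne (h.le_top hP x) hx)
        omega
  have hu' (n k : ℕ) (hk : n ≤ k) (P : FinPartOrd.{0}) (hP : P ∈ 𝓟) (hn : Fintype.card P ≤ n) :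
      (∑ i ∈ Finset.range k, u ^ i) (incidenceClass h K P hP) =
        (∑ i ∈ Finset.range n, u ^ i) (incidenceClass h K P hP) := by
    induction k, hk using Nat.le_induction with
    | base => rfl
    | succ k hk ih =>
      rw [Finset.sum_range_succ]
      refine Eq.trans (b := (∑ i ∈ Finset.range k, u ^ i) (incidenceClass h K P hP) +
        (u ^ k) (incidenceClass h K P hP)) rfl ?_
      rw [ih, hu k P hP (hn.trans hk), add_zero]
  -- The series is truncated at the cardinality of a chosen representative; by `hu'` any larger
  -- bound gives the same value.
  let S : IncidenceAlg K h →ₗ[K] IncidenceAlg K h := (incidenceBasis h K).constr K fun c =>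
    (∑ i ∈ Finset.range (Fintype.card c.2.choose), u ^ i) (incidenceBasis h K c)
  have hS (n : ℕ) (P : FinPartOrd.{0}) (hP : P ∈ 𝓟) (hn : Fintype.card P ≤ n) :
      S (incidenceClass h K P hP) =
        (∑ i ∈ Finset.range n, u ^ i) (incidenceClass h K P hP) := by
    rw [incidenceClass_eq_basis, Module.Basis.constr_basis, ← incidenceClass_eq_basis]
    obtain ⟨e⟩ := PosetClass.mk_eq_mk.1 (h.classOf P hP).2.choose_spec.2
    rw [Fintype.card_congr e.toEquiv]
    exact (hu' _ _ hn P hP le_rfl).symm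
  have hS' (P : FinPartOrd.{0}) (hP : P ∈ 𝓟) (x y : P) : S (intervalClass h K hP x y) =
      (∑ i ∈ Finset.range (Fintype.card P), u ^ i) (intervalClass h K hP x y) := by
    by_cases hxy : x ≤ y
    · rw [intervalClass_of_le hP hxy]
      exact hS _ _ _ (card_interval_le x y)
    · rw [intervalClass_of_not_le hP hxy, map_zero]
      exact (map_zero (∑ i ∈ Finset.range (Fintype.card P), u ^ i).ofConv).symm
  have hid : toConv LinearMap.id = 1 - u := (sub_sub_cancel _ _).symm
  have one_sub (P : FinPartOrd.{0}) (hP : P ∈ 𝓟) :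
      (1 - u ^ Fintype.card P) (incidenceClass h K P hP) =
        (1 : WithConv (IncidenceAlg K h →ₗ[K] IncidenceAlg K h)) (incidenceClass h K P hP) := by
    refine Eq.trans (b := (1 : WithConv (IncidenceAlg K h →ₗ[K] IncidenceAlg K h))
      (incidenceClass h K P hP) - (u ^ Fintype.card P) (incidenceClass h K P hP)) rfl ?_
    rw [hu _ P hP le_rfl, sub_zero]
  refine ⟨S, incidence_linearMap_ext fun P hP => ?_, incidence_linearMap_ext fun P hP => ?_⟩
  · refine Eq.trans (b := (toConv S * toConv LinearMap.id : WithConv (_ →ₗ[K] _)) (incidenceClass h K P hP)) rfl ?_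
    refine Eq.trans ?_ (one_sub P hP)
    -- Truncating at `n = Fintype.card P`, the telescoping product is `1 - u ^ n`, and `u ^ n`
    -- vanishes on `P`.
    rw [← geom_sum_mul_neg, ← hid, mul_apply, mul_apply]
    exact Finset.sum_congr rfl fun x _ => congrArg (· * _) (hS' P hP _ _)
  · refine Eq.trans (b := (toConv LinearMap.id * toConv S : WithConv (_ →ₗ[K] _)) (incidenceClass h K P hP)) rfl ?_
    refine Eq.trans ?_ (one_sub P hP)
    rw [← mul_neg_geom_sum, ← hid, mul_apply, mul_apply]
    exact Finset.sum_congr rfl fun x _ => congrArg (_ * ·) (hS' P hP _ _)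

/-- The incidence Hopf algebra of a hereditary family is a Hopf algebra. -/
theorem isHopf_incidence : IsHopf K (IncidenceAlg K h) where
  coassoc := incidence_coassoc
  rTensor_counit := incidence_rTensor_counit
  lTensor_counit := incidence_lTensor_counit
  counit_one := incidence_counit_one
  counit_mul := incidence_counit_mul
  comul_one := incidence_comul_one
  comul_mul := incidence_comul_mul
  exists_antipode := exists_antipode_incidence

end IncidenceHopf

/-! ### Posets of order ideals -/

section OrderIdeals

variable {P Q : FinPartOrd.{0}}

/-- Isomorphic posets have isomorphic posets of order ideals. -/
def orderIdealsCongr (e : P ≃o Q) : orderIdeals P ≃o orderIdeals Q :=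
  (LowerSet.map e : LowerSet P ≃o LowerSet Q)

theorem supIrred_orderIso {α β : Type*} [SemilatticeSup α] [SemilatticeSup β] (f : α ≃o β) {a : α}
    (ha : SupIrred a) : SupIrred (f a) := by
  refine ⟨fun hmin => ha.1 (f.isMin_apply.1 hmin), fun b c hbc => ?_⟩
  have : f.symm b ⊔ f.symm c = a := by rw [← f.symm.map_sup, hbc, f.symm_apply_apply]
  exact (ha.2 this).imp (fun h => by rw [← h, f.apply_symm_apply])
    (fun h => by rw [← h, f.apply_symm_apply])

/-- A finite poset is determined by its poset of order ideals. -/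
theorem nonempty_orderIso_of_orderIdeals (e : orderIdeals P ≃o orderIdeals Q) :
    Nonempty (P ≃o Q) := by
  classical
  let f : LowerSet P ≃o LowerSet Q := e
  -- The sup-irreducible order ideals are the principal ones, which form a copy of the poset; an
  -- isomorphism preserves sup-irreducibility.
  have hf (I : LowerSet P) : SupIrred I ↔ SupIrred (f I) :=
    ⟨supIrred_orderIso f, fun h => by simpa using supIrred_orderIso f.symm h⟩
  let g : {I : LowerSet P // SupIrred I} ≃o {I : LowerSet Q // SupIrred I} :=
    { toEquiv := f.toEquiv.subtypeEquiv hf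
      map_rel_iff' := f.map_rel_iff }
  exact ⟨(OrderIso.supIrredLowerSet.trans g).trans OrderIso.supIrredLowerSet.symm⟩

/-- The order ideals of a disjoint union are the pairs of order ideals of the summands. -/
def orderIdealsDisjUnion (P Q : FinPartOrd.{0}) :
    orderIdeals (disjUnion P Q) ≃o FinPartOrd.of (orderIdeals P × orderIdeals Q) where
  toFun (I : LowerSet (P ⊕ Q)) :=
    ((⟨{x | Sum.inl x ∈ I}, fun _ _ hba ha => I.lower (Sum.inl_le_inl_iff.2 hba) ha⟩ : LowerSet P),
      (⟨{x | Sum.inr x ∈ I}, fun _ _ hba ha => I.lower (Sum.inr_le_inr_iff.2 hba) ha⟩ :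
        LowerSet Q))
  invFun (I : LowerSet P × LowerSet Q) := (⟨{x | Sum.elim (· ∈ I.1) (· ∈ I.2) x}, by
    rintro _ _ (hba | hba) ha
    · exact I.1.lower hba ha
    · exact I.2.lower hba ha⟩ : LowerSet (P ⊕ Q))
  left_inv (I : LowerSet (P ⊕ Q)) := LowerSet.ext (by ext (x | x) <;> rfl)
  right_inv _ := rfl
  map_rel_iff' {I J : LowerSet (P ⊕ Q)} := by
    constructor
    · rintro ⟨h₁, h₂⟩ (x | x) hx
      · exact h₁ hx
      · exact h₂ hx
    · exact fun hIJ => ⟨fun x hx => hIJ hx, fun x hx => hIJ hx⟩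

/-- An interval `[I, J]` of order ideals is the poset of order ideals of `J \ I`. -/
def iccLowerSet {α : Type*} [PartialOrder α] (I J : LowerSet α) (hIJ : I ≤ J) :
    Set.Icc I J ≃o LowerSet ↥((J : Set α) \ I) where
  toFun L := ⟨{x | x.1 ∈ L.1}, fun _ _ hba ha => L.1.lower hba ha⟩
  invFun L := by
    refine ⟨⟨I ∪ {x | ∃ hx : x ∈ (J : Set α) \ I, ⟨x, hx⟩ ∈ L}, ?_⟩, ?_, ?_⟩
    · rintro a b hba (ha | ⟨hx, ha⟩)
      · exact Or.inl (I.lower hba ha)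
      -- Going down from `L` one either enters `I` or stays in `J \ I`, where `L` is a lower set.
      · by_cases hb : b ∈ I
        · exact Or.inl hb
        · exact Or.inr ⟨⟨J.lower hba hx.1, hb⟩, L.lower hba ha⟩
    · exact fun x hx => Or.inl hx
    · rintro x (hx | ⟨hx, -⟩)
      · exact hIJ hx
      · exact hx.1
  left_inv := by
    rintro ⟨L, hL₁, hL₂⟩
    refine Subtype.ext (LowerSet.ext (Set.ext fun x => ⟨?_, fun hx => ?_⟩))
    · rintro (hx | ⟨_, hx⟩)
      · exact hL₁ hx
      · exact hx
    · by_cases hxI : x ∈ I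
      · exact Or.inl hxI
      · exact Or.inr ⟨⟨hL₂ hx, hxI⟩, hx⟩
  right_inv := by
    intro L
    refine LowerSet.ext (Set.ext fun x => ⟨?_, fun hx => Or.inr ⟨x.2, hx⟩⟩)
    rintro (hx | ⟨_, hx⟩)
    · exact (x.2.2 hx).elim
    · exact hx
  map_rel_iff' := by
    rintro ⟨L, hL₁, hL₂⟩ ⟨M, hM₁, hM₂⟩
    refine ⟨fun hLM x hx => ?_, fun hLM x hx => hLM hx⟩
    by_cases hxI : x ∈ I
    · exact hM₁ hxI
    · exact hLM (a := ⟨x, hL₂ hx, hxI⟩) hx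

/-- The set `s` is kept separate from `J \ I` so that crowns and trunks can be used in the form in
which cuts present them. -/
theorem nonempty_interval_orderIdeals (I J : LowerSet P) (hIJ : I ≤ J) {s : Set P}
    (hs : s = (J : Set P) \ I) :
    Nonempty (interval (orderIdeals P) I J ≃o orderIdeals (subposet P s)) := by
  subst hs
  exact ⟨iccLowerSet I J hIJ⟩

/-- Isomorphic posets have isomorphic subposets. -/
def subposetCongr (e : P ≃o Q) (s : Set P) (t : Set Q) (h : ∀ x, x ∈ s ↔ e x ∈ t) :
    subposet P s ≃o subposet Q t where
  toEquiv := e.toEquiv.subtypeEquiv h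
  map_rel_iff' := e.map_rel_iff

/-- The union of two subsets without comparabilities between them is their disjoint union. -/
theorem nonempty_subposet_union (s t : Set P) (h : ∀ x ∈ s, ∀ y ∈ t, ¬ x ≤ y ∧ ¬ y ≤ x) :
    Nonempty (disjUnion (subposet P s) (subposet P t) ≃o subposet P (s ∪ t)) := by
  let f : s ⊕ t → ↥(s ∪ t) := Sum.elim (fun x => ⟨x, Or.inl x.2⟩) (fun x => ⟨x, Or.inr x.2⟩)
  have hf : ∀ a b : s ⊕ t, f a ≤ f b ↔ a ≤ b := by
    rintro (a | a) (b | b)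
    · exact (Sum.inl_le_inl_iff (a := a) (b := b)).symm
    · exact iff_of_false (h a.1 a.2 b.1 b.2).1 Sum.not_inl_le_inr
    · exact iff_of_false (h b.1 b.2 a.1 a.2).2 Sum.not_inr_le_inl
    · exact (Sum.inr_le_inr_iff (a := a) (b := b)).symm
  have hsurj : Function.Surjective f := by
    rintro ⟨x, hx | hx⟩
    · exact ⟨Sum.inl ⟨x, hx⟩, rfl⟩
    · exact ⟨Sum.inr ⟨x, hx⟩, rfl⟩
  have hinj : Function.Injective f := fun a b hab =>
    le_antisymm ((hf a b).1 hab.le) ((hf b a).1 hab.ge)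
  exact ⟨⟨Equiv.ofBijective f ⟨hinj, hsurj⟩, fun {a b} => hf a b⟩⟩

end OrderIdeals

/-! ### Rooted forests as posets -/

/-- A rooted tree as a rooted forest. -/
abbrev TreeGraph.toForest (T : TreeGraph) : ForestGraph where
  V := T.V
  Edge := T.Edge
  edge_unique {u u' v} hu hu' := by
    have hv : v ≠ T.root := by
      rintro rfl
      exact T.not_edge_root _ hu
    exact (T.existsUnique_edge v hv).unique hu hu'
  reach v := ⟨T.root, T.not_edge_root, T.reach v⟩

/-- The isomorphism class of a rooted tree. -/
def TreeGraph.toRootedTree (T : TreeGraph) : RootedTree := Quotient.mk treeSetoid T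

theorem TreeGraph.toRootedTree_out (t : RootedTree) :
    TreeGraph.toRootedTree (Quotient.out t) = t := Quotient.out_eq t

namespace ForestGraph

variable (F : ForestGraph)

variable {F} in
theorem le_iff {x y : F.V} : x ≤ y ↔ Relation.ReflTransGen F.Edge x y := by
  constructor
  · rintro ⟨-, -, -, hxy⟩
    exact hxy
  · intro hxy
    obtain ⟨r, hr, hrx⟩ := F.reach x
    exact ⟨r, hr, hrx, hxy⟩

variable {F} in
-- This characterises roots by the order alone, so poset isomorphisms preserve them.
theorem isRoot_iff_isMin {r : F.V} : F.IsRoot r ↔ IsMin r := by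
  constructor
  · intro hr x hx
    rcases Relation.ReflTransGen.cases_tail (le_iff.1 hx) with h | ⟨u, -, hu⟩
    · exact h.le
    · exact (hr u hu).elim
  · intro hr u hu
    have hru : r ≤ u := hr (le_iff.2 (.single hu))
    exact F.not_cycle u (Relation.TransGen.head' hu (le_iff.1 hru))

variable {F} in
theorem IsRoot.eq_of_le {r r' v : F.V} (hr : F.IsRoot r) (hr' : F.IsRoot r') (h : r ≤ v)
    (h' : r' ≤ v) : r = r' := by
  -- Incoming edges being unique, the paths from `r` and `r'` to `v` agree when followed backwards,
  -- until one of them stops at its root.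
  suffices r ≤ r' from le_antisymm this (isRoot_iff_isMin.1 hr' this)
  rw [le_iff] at h
  induction h with
  | refl => exact isRoot_iff_isMin.1 hr h'
  | tail hb hbc ih =>
    rcases Relation.ReflTransGen.cases_tail (le_iff.1 h') with h | ⟨u, hu, huv⟩
    · subst h
      exact (hr' _ hbc).elim
    · obtain rfl := F.edge_unique huv hbc
      exact ih (le_iff.2 hu)

variable {F} in
-- Convexity keeps every vertex of a path between two points of `W` inside `W`; otherwise the
-- restricted graph could lose the path.
theorem reflTransGen_subtype_iff {W : Set F.V} (hW : W.OrdConnected) (a b : W) :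
    Relation.ReflTransGen (fun x y : W => F.Edge x y) a b ↔ a.1 ≤ b.1 := by
  constructor
  · exact fun h => le_iff.2 (Relation.ReflTransGen.lift Subtype.val (fun _ _ h => h) _ _ h)
  · obtain ⟨b, hb⟩ := b
    intro h
    replace h : Relation.ReflTransGen F.Edge a.1 b := le_iff.1 h
    induction h with
    | refl => exact .refl
    | @tail c d hc hcd ih =>
      have hcW : c ∈ W := hW.out a.2 hb ⟨le_iff.2 hc, le_iff.2 (.single hcd)⟩
      exact (ih hcW).tail hcd

/-- The subforest supported on a convex subset carries the induced order. -/
def restrictIso {W : Set F.V} (hW : W.OrdConnected) :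
    (F.restrict W).poset ≃o subposet F.poset W where
  toEquiv := Equiv.refl W
  map_rel_iff' {a b} := (reflTransGen_subtype_iff hW a b).symm.trans
    (le_iff (F := F.restrict W) (x := a) (y := b)).symm

/-- The component at a root carries the induced order. -/
def treeAtIso {r : F.V} (hr : F.IsRoot r) :
    (F.treeAt r hr).poset ≃o subposet F.poset {v : F.V | r ≤ v} where
  toEquiv := Equiv.subtypeEquivRight fun v => (le_iff (x := r) (y := v)).symm
  map_rel_iff' {a b} := by
    have hW : {v : F.V | Relation.ReflTransGen F.Edge r v}.OrdConnected :=
      ⟨fun x hx y _ z hz => Relation.ReflTransGen.trans hx (le_iff.1 hz.1)⟩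
    exact (reflTransGen_subtype_iff hW a b).symm.trans
      (le_iff (F := (F.treeAt r hr).toForest) (x := a) (y := b)).symm

/-- The disjoint union of two rooted forests. -/
def sum (F G : ForestGraph) : ForestGraph where
  V := F.V ⊕ G.V
  Edge := Sum.LiftRel F.Edge G.Edge
  edge_unique := by
    rintro _ _ _ (h | h) (h' | h')
    · rw [F.edge_unique h h']
    · rw [G.edge_unique h h']
  reach := by
    rintro (v | v)
    · obtain ⟨r, hr, hrv⟩ := F.reach v
      refine ⟨Sum.inl r, ?_, Relation.ReflTransGen.lift Sum.inl (fun _ _ => .inl) _ _ hrv⟩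
      rintro _ (h | h)
      exact hr _ h
    · obtain ⟨r, hr, hrv⟩ := G.reach v
      refine ⟨Sum.inr r, ?_, Relation.ReflTransGen.lift Sum.inr (fun _ _ => .inr) _ _ hrv⟩
      rintro _ (h | h)
      exact hr _ h

theorem reflTransGen_sum_iff (F G : ForestGraph) (a b : F.V ⊕ G.V) :
    Relation.ReflTransGen (Sum.LiftRel F.Edge G.Edge) a b ↔ a ≤ b := by
  constructor
  · intro h
    induction h with
    | refl => exact le_rfl
    | tail _ h ih =>
      refine ih.trans ?_
      rcases h with h | h
      · exact Sum.inl_le_inl_iff.2 (le_iff.2 (.single h))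
      · exact Sum.inr_le_inr_iff.2 (le_iff.2 (.single h))
  · rintro (h | h)
    · exact Relation.ReflTransGen.lift Sum.inl (fun _ _ => .inl) _ _ (le_iff.1 h)
    · exact Relation.ReflTransGen.lift Sum.inr (fun _ _ => .inr) _ _ (le_iff.1 h)

/-- The poset of a disjoint union of rooted forests. -/
def sumIso (F G : ForestGraph) : (F.sum G).poset ≃o disjUnion F.poset G.poset where
  toEquiv := Equiv.refl (F.V ⊕ G.V)
  map_rel_iff' {a b} := (reflTransGen_sum_iff F G a b).symm.trans
    (le_iff (F := F.sum G) (x := a) (y := b)).symm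

/-! ### The multiset of trees as an isomorphism invariant -/

/-- The multiset of the trees of a rooted forest. -/
def trees : RootedTree →₀ ℕ :=
  letI : Fintype {r : F.V // F.IsRoot r} := Fintype.ofFinite _
  ∑ r : {r : F.V // F.IsRoot r}, Finsupp.single (F.treeAt r.1 r.2).toRootedTree 1

-- Roots are the minimal vertices and each tree is the set of vertices above its root; both notions
-- depend only on the order.
variable {F} in
theorem trees_congr {G : ForestGraph} (e : F.poset ≃o G.poset) : F.trees = G.trees := by
  let f : F.V ≃o G.V := e
  have hf (r : F.V) : F.IsRoot r ↔ G.IsRoot (f r) := by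
    rw [isRoot_iff_isMin, isRoot_iff_isMin, f.isMin_apply]
  let : Fintype {r : F.V // F.IsRoot r} := Fintype.ofFinite _
  let : Fintype {r : G.V // G.IsRoot r} := Fintype.ofFinite _
  refine Fintype.sum_equiv (f.toEquiv.subtypeEquiv hf) _ _ fun r => ?_
  congr 1
  exact Quotient.sound ⟨((F.treeAtIso r.2).trans
    (subposetCongr e _ _ fun x => f.le_iff_le.symm)).trans (G.treeAtIso ((hf r.1).1 r.2)).symm⟩

theorem isRoot_ofTrees_iff {ι : Type} [Finite ι] (T : ι → TreeGraph) (i : ι) (v : (T i).V) :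
    (ofTrees T).IsRoot ⟨i, v⟩ ↔ v = (T i).root := by
  constructor
  · intro hv
    by_contra hne
    obtain ⟨u, hu, -⟩ := (T i).existsUnique_edge v hne
    exact hv _ (UnionEdge.mk i u v hu)
  · rintro rfl _ ⟨_, a, _, hab⟩
    exact (T i).not_edge_root _ hab

theorem reflTransGen_ofTrees_iff {ι : Type} [Finite ι] (T : ι → TreeGraph) (i : ι)
    (a : (T i).V) (x : Σ i, (T i).V) :
    Relation.ReflTransGen (ofTrees T).Edge ⟨i, a⟩ x ↔
      ∃ b, Relation.ReflTransGen (T i).Edge a b ∧ x = ⟨i, b⟩ := by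
  constructor
  · intro h
    induction h with
    | refl => exact ⟨a, .refl, rfl⟩
    | tail _ h ih =>
      obtain ⟨b, hb, rfl⟩ := ih
      cases h with
      | mk _ _ c hc => exact ⟨c, hb.tail hc, rfl⟩
  · rintro ⟨b, hb, rfl⟩
    exact Relation.ReflTransGen.lift (fun a => (⟨i, a⟩ : Σ i, (T i).V))
      (fun a b hab => UnionEdge.mk i a b hab) _ _ hb

theorem trees_ofTrees {ι : Type} [Fintype ι] (T : ι → TreeGraph) :
    (ofTrees T).trees = ∑ i, Finsupp.single (T i).toRootedTree 1 := by
  let f : ι → {r : (ofTrees T).V // (ofTrees T).IsRoot r} := fun i =>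
    ⟨⟨i, (T i).root⟩, (isRoot_ofTrees_iff T i _).2 rfl⟩
  have hf : Function.Bijective f := by
    constructor
    · intro i j hij
      exact congrArg (fun x => x.1.1) hij
    · rintro ⟨⟨i, v⟩, hv⟩
      obtain rfl := (isRoot_ofTrees_iff T i v).1 hv
      exact ⟨i, rfl⟩
  let : Fintype {r : (ofTrees T).V // (ofTrees T).IsRoot r} := Fintype.ofFinite _
  refine (Fintype.sum_bijective f hf _ _ fun i => ?_).symm
  congr 1
  refine Quotient.sound ⟨OrderIso.trans ?_ ((ofTrees T).treeAtIso (f i).2).symm⟩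
  let g : (T i).V → {v : (ofTrees T).V | (f i).1 ≤ v} := fun a =>
    ⟨⟨i, a⟩, le_iff.2 ((reflTransGen_ofTrees_iff T i _ _).2 ⟨a, (T i).reach a, rfl⟩)⟩
  have hg : Function.Bijective g := by
    constructor
    · intro a b hab
      exact eq_of_heq (Sigma.mk.inj (congrArg Subtype.val hab)).2
    · rintro ⟨x, hx⟩
      obtain ⟨b, -, rfl⟩ := (reflTransGen_ofTrees_iff T i _ _).1 (le_iff.1 hx)
      exact ⟨b, rfl⟩
  refine ⟨Equiv.ofBijective g hg, fun {a b} => ?_⟩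
  refine (le_iff (F := ofTrees T)).trans
    (Iff.trans ?_ (le_iff (F := (T i).toForest) (x := a) (y := b)).symm)
  refine (reflTransGen_ofTrees_iff T i a _).trans ⟨?_, fun h => ⟨b, h, rfl⟩⟩
  rintro ⟨c, hc, h⟩
  obtain rfl : b = c := eq_of_heq (Sigma.mk.inj h).2
  exact hc

theorem trees_monomialForest (m : RootedTree →₀ ℕ) : (monomialForest m).trees = m := by
  rw [monomialForest, trees_ofTrees]
  simp only [TreeGraph.toRootedTree_out, List.get_eq_getElem]
  rw [Fin.sum_univ_fun_getElem m.toMultiset.toList (fun t => Finsupp.single t 1),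
    ← Multiset.sum_coe, ← Multiset.map_coe, Multiset.coe_toList]
  classical
  -- As multisets, the two sides are a sum of singletons and the multiset they make up.
  refine Finsupp.orderIsoMultiset.injective ?_
  change Finsupp.toMultiset _ = Finsupp.toMultiset m
  simp [map_multiset_sum]

end ForestGraph

/-! ### Closure properties of the family of rooted forests -/

theorem disjUnion_mem_rootedForests {P Q : FinPartOrd.{0}} (hP : P ∈ rootedForests)
    (hQ : Q ∈ rootedForests) : disjUnion P Q ∈ rootedForests := by
  obtain ⟨F, ⟨e⟩⟩ := hP
  obtain ⟨G, ⟨f⟩⟩ := hQ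
  exact ⟨F.sum G, ⟨(OrderIso.sumCongr e f : disjUnion P Q ≃o disjUnion F.poset G.poset).trans
    (F.sumIso G).symm⟩⟩

theorem subposet_mem_rootedForests {P : FinPartOrd.{0}} (hP : P ∈ rootedForests) {s : Set P}
    (hs : s.OrdConnected) : subposet P s ∈ rootedForests := by
  obtain ⟨F, ⟨e⟩⟩ := hP
  have ht : (e.symm ⁻¹' s).OrdConnected := hs.preimage_mono e.symm.monotone
  exact ⟨F.restrict (e.symm ⁻¹' s), ⟨(subposetCongr e s (e.symm ⁻¹' s) fun x => by simp).trans
    (F.restrictIso ht).symm⟩⟩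

theorem ordConnected_sdiff {α : Type*} [PartialOrder α] (I J : LowerSet α) :
    ((J : Set α) \ I).OrdConnected :=
  ⟨fun _ hx _ hy _ hz => ⟨J.lower hz.2 hy.1, fun h => hx.2 (I.lower hz.1 h)⟩⟩

/-- Intervals come from the convex sets `J \ I` and products from disjoint unions; nothing else
about forests is needed. -/
theorem isHereditary_orderIdealFamily {ℱ : Set FinPartOrd.{0}} (hne : ℱ.Nonempty)
    (hunion : ∀ P ∈ ℱ, ∀ Q ∈ ℱ, disjUnion P Q ∈ ℱ)
    (hconvex : ∀ P ∈ ℱ, ∀ s : Set P, s.OrdConnected → subposet P s ∈ ℱ) :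
    IsHereditary (orderIdealFamily ℱ) where
  nonempty := hne.imp' orderIdeals fun _ => orderIdeals_mem
  exists_bot := by
    rintro L ⟨P, -, ⟨e⟩⟩
    exact ⟨e.symm (⊥ : LowerSet P), fun x => e.symm_apply_le.2 (bot_le (α := LowerSet P))⟩
  exists_top := by
    rintro L ⟨P, -, ⟨e⟩⟩
    exact ⟨e.symm (⊤ : LowerSet P), fun x => e.le_symm_apply.2 (le_top (α := LowerSet P))⟩
  interval_mem := by
    rintro L ⟨P, hP, ⟨e⟩⟩ x y hxy
    obtain ⟨f⟩ := interval_congr e (rfl : e x = e x) (rfl : e y = e y)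
    obtain ⟨g⟩ := nonempty_interval_orderIdeals (e x) (e y) (e.monotone hxy) rfl
    exact ⟨_, hconvex P hP _ (ordConnected_sdiff _ _), ⟨f.trans g⟩⟩
  prod_mem := by
    rintro L ⟨P, hP, ⟨e⟩⟩ M ⟨Q, hQ, ⟨f⟩⟩
    let g : FinPartOrd.of (L × M) ≃o FinPartOrd.of (orderIdeals P × orderIdeals Q) :=
      ⟨e.toEquiv.prodCongr f.toEquiv, and_congr e.map_rel_iff f.map_rel_iff⟩
    exact ⟨_, hunion P hP Q hQ, ⟨g.trans (orderIdealsDisjUnion P Q).symm⟩⟩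

theorem isHereditary_rootedForests : IsHereditary (orderIdealFamily rootedForests) :=
  -- The empty forest witnesses nonemptiness.
  isHereditary_orderIdealFamily ⟨_, (ForestGraph.ofTrees Empty.elim).poset_mem⟩
    (fun _ hP _ hQ => disjUnion_mem_rootedForests hP hQ) fun _ hP _ => subposet_mem_rootedForests hP

/-! ### Decomposition of a rooted forest into its trees -/

namespace PosetClass

/-- The class of the poset of order ideals. -/
def ofIdeals (P : FinPartOrd.{0}) : PosetClass := PosetClass.mk (orderIdeals P)

theorem ofIdeals_congr {P Q : FinPartOrd.{0}} (e : P ≃o Q) : ofIdeals P = ofIdeals Q :=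
  mk_eq_mk.2 ⟨orderIdealsCongr e⟩

theorem ofIdeals_disjUnion (P Q : FinPartOrd.{0}) :
    ofIdeals (disjUnion P Q) = ofIdeals P * ofIdeals Q :=
  mk_eq_mk.2 ⟨orderIdealsDisjUnion P Q⟩

theorem ofIdeals_of_isEmpty {P : FinPartOrd.{0}} [IsEmpty P] : ofIdeals P = 1 :=
  mk_eq_one (P := orderIdeals P) (⊥ : LowerSet P) fun (_ : LowerSet P) =>
    LowerSet.ext (Set.eq_empty_of_isEmpty _)

end PosetClass

namespace ForestGraph

/-- Trees at distinct roots are incomparable, so adding the roots one at a time to `s` splits off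
one disjoint summand, hence one factor, at each stage. -/
theorem ofIdeals_eq_prod (F : ForestGraph) [Fintype {r : F.V // F.IsRoot r}] :
    PosetClass.ofIdeals F.poset =
      ∏ r : {r : F.V // F.IsRoot r}, PosetClass.ofIdeals (F.treeAt r.1 r.2).poset := by
  classical
  have key (s : Finset {r : F.V // F.IsRoot r}) :
      PosetClass.ofIdeals (subposet F.poset {v : F.V | ∃ r ∈ s, r.1 ≤ v}) =
        ∏ r ∈ s, PosetClass.ofIdeals (F.treeAt r.1 r.2).poset := by
    induction s using Finset.induction_on with
    | empty =>
      rw [Finset.prod_empty]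
      have : IsEmpty (subposet F.poset {v : F.V | ∃ r ∈ (∅ : Finset {r : F.V // F.IsRoot r}),
          r.1 ≤ v}) := ⟨by rintro ⟨v, r, hr, -⟩; simp at hr⟩
      exact PosetClass.ofIdeals_of_isEmpty
    | insert a s ha ih =>
      have hset : {v : F.V | ∃ r ∈ insert a s, r.1 ≤ v} =
          {v : F.V | a.1 ≤ v} ∪ {v : F.V | ∃ r ∈ s, r.1 ≤ v} := by
        ext v
        simp
      obtain ⟨e⟩ := nonempty_subposet_union (P := F.poset) {v : F.V | a.1 ≤ v}
        {v : F.V | ∃ r ∈ s, r.1 ≤ v} (by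
          rintro x hx y ⟨r, hr, hry⟩
          have hne : a ≠ r := by
            rintro rfl
            exact ha hr
          exact ⟨fun hxy => hne (Subtype.ext (a.2.eq_of_le r.2 (le_trans (α := F.V) hx hxy) hry)),
            fun hyx => hne (Subtype.ext (a.2.eq_of_le r.2 hx (le_trans (α := F.V) hry hyx)))⟩)
      rw [Finset.prod_insert ha, ← ih, PosetClass.ofIdeals_congr (F.treeAtIso a.2),
        ← PosetClass.ofIdeals_disjUnion, PosetClass.ofIdeals_congr e]
      exact congrArg (fun t => PosetClass.ofIdeals (subposet F.poset t)) hset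
  rw [← key]
  refine PosetClass.ofIdeals_congr
    { toFun := fun v => ⟨v, ?_⟩
      invFun := fun v => v.1
      left_inv := fun _ => rfl
      right_inv := fun _ => rfl
      map_rel_iff' := Iff.rfl }
  obtain ⟨r, hr, hrv⟩ := F.reach v
  exact ⟨⟨r, hr⟩, Finset.mem_univ _, le_iff.2 hrv⟩

end ForestGraph

/-! ### The isomorphism -/

section Iso

variable (K : Type u) [Field K]

/-- The basis of the algebra of rooted trees formed by the monomials. -/
def forestBasis : Module.Basis (RootedTree →₀ ℕ) K (HRT K) :=
  MvPolynomial.basisMonomials RootedTree K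

theorem forestElt_eq_basis (F : ForestGraph) : forestElt K F = forestBasis K F.trees := by
  have h : forestBasis K F.trees = (MvPolynomial.monomial F.trees 1 : MvPolynomial RootedTree K) :=
    congrFun (MvPolynomial.coe_basisMonomials RootedTree K) F.trees
  rw [h, ForestGraph.trees, MvPolynomial.monomial_sum_one]
  rfl

theorem forestBasis_eq (m : RootedTree →₀ ℕ) :
    forestBasis K m = forestElt K (monomialForest m) := by
  rw [forestElt_eq_basis, ForestGraph.trees_monomialForest]

theorem comul_forestBasis (m : RootedTree →₀ ℕ) :
    CoalgebraStruct.comul (R := K) (forestBasis K m) = cutSum K (monomialForest m) :=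
  (forestBasis K).constr_basis K _ m

theorem counit_forestBasis (m : RootedTree →₀ ℕ) [Decidable (m = 0)] :
    CoalgebraStruct.counit (R := K) (forestBasis K m) = if m = 0 then 1 else 0 := by
  refine ((forestBasis K).constr_basis K _ m).trans ?_
  congr

variable (h : IsHereditary (orderIdealFamily rootedForests))

/-- The class of the poset of order ideals of a rooted forest. -/
def idealsClass (F : ForestGraph) : IncidenceAlg K h :=
  incidenceClass h K (orderIdeals F.poset) (orderIdeals_mem F.poset_mem)

variable {K} in
theorem idealsClass_congr {F G : ForestGraph} (e : F.poset ≃o G.poset) :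
    idealsClass K h F = idealsClass K h G :=
  incidenceClass_congr (orderIdealsCongr e)

/-- The morphism of algebras which sends a rooted tree to the class of its poset of order
ideals. -/
def ofForests : HRT K →ₐ[K] IncidenceAlg K h :=
  (MvPolynomial.aeval fun t : RootedTree => idealsClass K h (Quotient.out t).toForest :
    MvPolynomial RootedTree K →ₐ[K] IncidenceAlg K h)

theorem ofForests_treeGen (T : TreeGraph) :
    ofForests K h (treeGen K (Quotient.mk treeSetoid T)) = idealsClass K h T.toForest := by
  refine (MvPolynomial.aeval_X (R := K) (fun t : RootedTree =>
    idealsClass K h (Quotient.out t).toForest) (T.toRootedTree)).trans ?_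
  obtain ⟨e⟩ := Quotient.exact (Quotient.out_eq (s := treeSetoid) (Quotient.mk treeSetoid T))
  exact idealsClass_congr h e

/-- The morphism is prescribed on trees only; the decomposition `ofIdeals_eq_prod` extends the
formula to forests. -/
theorem ofForests_forestElt (F : ForestGraph) :
    ofForests K h (forestElt K F) = idealsClass K h F := by
  let : Fintype {r : F.V // F.IsRoot r} := Fintype.ofFinite _
  have hclass : h.classOf (orderIdeals F.poset) (orderIdeals_mem F.poset_mem) =
      ∏ r : {r : F.V // F.IsRoot r}, h.classOf (orderIdeals (F.treeAt r.1 r.2).poset)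
        (orderIdeals_mem (F.treeAt r.1 r.2).toForest.poset_mem) := by
    refine Subtype.ext ?_
    rw [Submonoid.coe_finsetProd]
    exact F.ofIdeals_eq_prod
  let φ : h.classes →* IncidenceAlg K h :=
    { toFun := incidenceBasis h K
      map_one' := incidenceBasis_one
      map_mul' := incidenceBasis_mul }
  refine (map_prod (ofForests K h) _ _).trans ?_
  refine Eq.trans ?_ (congrArg φ hclass).symm
  rw [map_prod]
  exact Finset.prod_congr rfl fun r _ => ofForests_treeGen K h _

theorem nonempty_iso_of_idealsClass_eq {F G : ForestGraph}
    (hFG : idealsClass K h F = idealsClass K h G) : Nonempty (F.poset ≃o G.poset) := by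
  have := (incidenceBasis h K).injective hFG
  obtain ⟨e⟩ := PosetClass.mk_eq_mk.1 (congrArg Subtype.val this)
  exact nonempty_orderIso_of_orderIdeals e

/-- Multisets of rooted trees correspond to classes of posets of order ideals. -/
theorem bijective_class : Function.Bijective fun m : RootedTree →₀ ℕ =>
    h.classOf (orderIdeals (monomialForest m).poset)
      (orderIdeals_mem (monomialForest m).poset_mem) := by
  constructor
  · intro m n hmn
    -- No field occurs in the statement; `ℚ` is an auxiliary one, used to compare classes as basis
    -- vectors.
    obtain ⟨e⟩ := nonempty_iso_of_idealsClass_eq ℚ h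
      (F := monomialForest m) (G := monomialForest n)
      (congrArg (incidenceBasis h ℚ) hmn)
    rw [← ForestGraph.trees_monomialForest m, ForestGraph.trees_congr e,
      ForestGraph.trees_monomialForest]
  · rintro ⟨_, L, hL, rfl⟩
    obtain ⟨P, ⟨F, ⟨e⟩⟩, ⟨f⟩⟩ := id hL
    refine ⟨F.trees, (incidenceBasis h ℚ).injective ?_⟩
    refine Eq.trans (b := idealsClass ℚ h (monomialForest F.trees)) rfl ?_
    rw [← ofForests_forestElt, ← forestBasis_eq, ← forestElt_eq_basis, ofForests_forestElt]
    exact (incidenceClass_congr (hP := hL) (hQ := orderIdeals_mem F.poset_mem)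
      (f.trans (orderIdealsCongr e))).symm

theorem bijective_ofForests : Function.Bijective (ofForests K h) := by
  -- The morphism carries the monomial basis bijectively onto the basis of classes.
  let E := (forestBasis K).equiv (incidenceBasis h K) (Equiv.ofBijective _ (bijective_class h))
  have : (ofForests K h).toLinearMap = E.toLinearMap := by
    refine (forestBasis K).ext fun m => ?_
    refine Eq.trans ?_ (Module.Basis.equiv_apply _ _ _ _).symm
    rw [forestBasis_eq]
    exact ofForests_forestElt K h _
  have h' : ⇑(ofForests K h) = ⇑E := congrArg DFunLike.coe this
  rw [h']
  exact E.bijective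

/-- The isomorphism of algebras which sends the class of the poset of order ideals of a rooted
forest to this forest. -/
def toForests : IncidenceAlg K h ≃ₐ[K] HRT K :=
  (AlgEquiv.ofBijective (ofForests K h) (bijective_ofForests K h)).symm

theorem toForests_idealsClass (F : ForestGraph) :
    toForests K h (idealsClass K h F) = forestElt K F := by
  rw [← ofForests_forestElt]
  exact (AlgEquiv.ofBijective (ofForests K h) (bijective_ofForests K h)).symm_apply_apply _

/-! ### Admissible cuts as order ideals, and the coproducts -/

theorem ForestGraph.isAdmissibleCut_iff (F : ForestGraph) (W : Set F.V) :
    F.IsAdmissibleCut W ↔ IsLowerSet W := by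
  constructor
  · intro hW y x hxy hy
    by_contra hx
    exact (hW x hx y hy (Or.inl hxy)).not_ge hxy
  · rintro hW x hx y hy (hxy | hyx)
    · exact (hx (hW hxy hy)).elim
    · refine lt_of_le_of_ne hyx ?_
      rintro rfl
      exact hx hy

/-- An ideal `I` is the trunk of a cut: `[⊥, I]` is `J` of the trunk and `[I, ⊤]` is `J` of the
crown. The factors come in the opposite order to `cutSum`. -/
theorem map_toForests_comul_idealsClass (F : ForestGraph) :
    TensorProduct.map (toForests K h).toLinearMap (toForests K h).toLinearMap
      (CoalgebraStruct.comul (R := K) (idealsClass K h F)) =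
        TensorProduct.comm K (HRT K) (HRT K) (cutSum K F) := by
  classical
  have hcls (I J : LowerSet F.poset) (hIJ : I ≤ J) (s : Set F.V) (hs : s = {x | x ∈ J ∧ x ∉ I}) :
      toForests K h (intervalClass h K (orderIdeals_mem F.poset_mem) I J) =
        forestElt K (F.restrict s) := by
    obtain ⟨e⟩ := nonempty_interval_orderIdeals I J hIJ hs
    have hconn : s.OrdConnected := hs ▸ ordConnected_sdiff I J
    rw [← toForests_idealsClass K h]
    exact congrArg _ ((intervalClass_of_le (h := h) (orderIdeals_mem F.poset_mem) hIJ).trans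
      (incidenceClass_congr (e.trans (orderIdealsCongr (F.restrictIso hconn)).symm)))
  rw [idealsClass, comul_incidenceClass, incidenceSum_eq _ (b := (⊥ : LowerSet F.poset))
    (t := (⊤ : LowerSet F.poset)) (fun _ => bot_le (α := LowerSet F.poset))
    (fun _ => le_top (α := LowerSet F.poset)), map_sum, cutSum, map_sum]
  let : Fintype F.V := Fintype.ofFinite _
  let cuts : orderIdeals F.poset ≃ {W : Set F.V // F.IsAdmissibleCut W} :=
    { toFun := fun I : LowerSet F.poset => ⟨I.carrier, (F.isAdmissibleCut_iff _).2 I.lower⟩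
      invFun := fun W => (⟨W.1, (F.isAdmissibleCut_iff _).1 W.2⟩ : LowerSet F.poset)
      left_inv := fun _ => rfl
      right_inv := fun _ => rfl }
  refine Fintype.sum_equiv cuts _ _ fun I : LowerSet F.poset => ?_
  rw [TensorProduct.map_tmul, TensorProduct.comm_tmul]
  refine congrArg₂ _ (hcls ⊥ I bot_le _ ?_) (hcls I ⊤ le_top _ ?_)
  · exact Set.ext fun x => ⟨fun hx => ⟨hx, fun hx' => hx'⟩, fun hx => hx.1⟩
  · exact Set.ext fun x => ⟨fun hx => ⟨trivial, hx⟩, fun hx => hx.2⟩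

/-- Up to the flip, `cutSum` is the image of a coproduct that depends only on the class of `J(F)`.
Hence it takes the same value on `F` and on the representative `monomialForest F.trees`. -/
theorem comul_forestElt (F : ForestGraph) :
    CoalgebraStruct.comul (R := K) (forestElt K F) = cutSum K F := by
  have h := isHereditary_rootedForests
  have hF : idealsClass K h (monomialForest F.trees) = idealsClass K h F := by
    rw [← ofForests_forestElt, ← forestBasis_eq, ← forestElt_eq_basis, ofForests_forestElt]
  rw [forestElt_eq_basis, comul_forestBasis]
  apply (TensorProduct.comm K (HRT K) (HRT K)).injective
  rw [← map_toForests_comul_idealsClass K h, ← map_toForests_comul_idealsClass K h, hF]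

variable {K} in
theorem idealsClass_linearMap_ext {M : Type*} [AddCommMonoid M] [Module K M]
    {φ ψ : IncidenceAlg K h →ₗ[K] M}
    (hφψ : ∀ F, φ (idealsClass K h F) = ψ (idealsClass K h F)) : φ = ψ := by
  refine incidence_linearMap_ext ?_
  rintro L ⟨P, ⟨F, ⟨e⟩⟩, ⟨f⟩⟩
  have hL := incidenceClass_congr (h := h) (K := K) (hP := ⟨P, ⟨F, ⟨e⟩⟩, ⟨f⟩⟩)
    (hQ := orderIdeals_mem F.poset_mem) (f.trans (orderIdealsCongr e))
  exact (congrArg _ hL).trans ((hφψ F).trans (congrArg _ hL).symm)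

theorem map_toForests_comul (x : IncidenceAlg K h) :
    TensorProduct.map (toForests K h).toLinearMap (toForests K h).toLinearMap
      (CoalgebraStruct.comul (R := K) x) =
        TensorProduct.comm K (HRT K) (HRT K)
          (CoalgebraStruct.comul (R := K) (toForests K h x)) := by
  have : TensorProduct.map (toForests K h).toLinearMap (toForests K h).toLinearMap ∘ₗ
      CoalgebraStruct.comul (R := K) = (TensorProduct.comm K (HRT K) (HRT K)).toLinearMap ∘ₗ
        CoalgebraStruct.comul (R := K) ∘ₗ (toForests K h).toLinearMap := by
    refine idealsClass_linearMap_ext h fun F => ?_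
    refine (map_toForests_comul_idealsClass K h F).trans ?_
    rw [← comul_forestElt, ← toForests_idealsClass K h]
    rfl
  exact congr($this x)

theorem class_zero : h.classOf (orderIdeals (monomialForest 0).poset)
    (orderIdeals_mem (monomialForest 0).poset_mem) = 1 := by
  refine (incidenceBasis h ℚ).injective ?_
  have hone : forestBasis ℚ 0 = 1 :=
    (congrFun (MvPolynomial.coe_basisMonomials RootedTree ℚ) 0).trans rfl
  have := ofForests_forestElt ℚ h (monomialForest 0)
  rw [← forestBasis_eq, hone, map_one] at this
  exact this.symm

/-- On monomials this says that only the empty one has the unit class, which follows from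
injectivity in `bijective_class`. -/
theorem counit_toForests (x : IncidenceAlg K h) :
    CoalgebraStruct.counit (R := K) (toForests K h x) = CoalgebraStruct.counit (R := K) x := by
  classical
  obtain ⟨y, rfl⟩ := (toForests K h).symm.surjective x
  rw [AlgEquiv.apply_symm_apply]
  have : CoalgebraStruct.counit (R := K) (A := HRT K) =
      CoalgebraStruct.counit (R := K) ∘ₗ (ofForests K h).toLinearMap := by
    refine (forestBasis K).ext fun m => ?_
    rw [counit_forestBasis, LinearMap.comp_apply, AlgHom.toLinearMap_apply, forestBasis_eq,
      ofForests_forestElt]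
    refine Eq.trans ?_ (counit_incidenceBasis _).symm
    refine if_congr ?_ rfl rfl
    rw [← (bijective_class h).injective.eq_iff, class_zero]
  exact congr($this y)

/-- Composing `toForests` with the automorphism `S`, which reverses the coproduct, makes two flips
cancel. -/
theorem exists_hopfIso : ∃ f : IncidenceAlg K h ≃ₐ[K] HRT K,
    (∀ a, CoalgebraStruct.comul (R := K) (f a) =
      TensorProduct.map f.toLinearMap f.toLinearMap (CoalgebraStruct.comul (R := K) a)) ∧
    ∀ a, CoalgebraStruct.counit (R := K) (f a) = CoalgebraStruct.counit (R := K) a := by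
  obtain ⟨S, hS, hS'⟩ := (isHopf_incidence (K := K) (h := h)).exists_flip
  refine ⟨S.trans (toForests K h), fun a => ?_, fun a => (counit_toForests K h _).trans (hS' a)⟩
  apply (TensorProduct.comm K (HRT K) (HRT K)).injective
  refine (map_toForests_comul K h (S a)).symm.trans ?_
  rw [hS]
  induction CoalgebraStruct.comul (R := K) a with
  | zero => simp
  | add x y hx hy => simp only [map_add, hx, hy]
  | tmul x y => rfl

end Iso

end IncHopf

end

theorem mainTheorem8 (K : Type*) [Field K] :
    -- rooted forests are stable by disjoint unions and convex subposets
    (∀ P ∈ rootedForests, ∀ Q ∈ rootedForests, disjUnion P Q ∈ rootedForests) ∧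
    (∀ P ∈ rootedForests, ∀ s : Set P, s.OrdConnected → subposet P s ∈ rootedForests) ∧
    -- the coproduct of every rooted forest is given by its admissible cuts
    (∀ F : ForestGraph, CoalgebraStruct.comul (R := K) (forestElt K F) = cutSum K F) ∧
    IsHopf K (HRT K) ∧
    -- the lattices of order ideals of rooted forests have an incidence Hopf algebra
    ∃ h : IsHereditary (orderIdealFamily rootedForests),
      IsHopf K (IncidenceAlg K h) ∧
      -- the two Hopf algebras are isomorphic
      Nonempty (IncidenceAlg K h ≃ₐc[K] HRT K) ∧
      -- the map sending the class of `J(F)` to `F` is an isomorphism up to a flip of the coproduct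
      ∃ e : IncidenceAlg K h ≃ₐ[K] HRT K,
        (∀ F : ForestGraph,
          e (incidenceClass h K (orderIdeals F.poset) (orderIdeals_mem F.poset_mem)) =
            forestElt K F) ∧
        (∀ x, TensorProduct.map e.toLinearMap e.toLinearMap (CoalgebraStruct.comul (R := K) x) =
          TensorProduct.comm K (HRT K) (HRT K) (CoalgebraStruct.comul (R := K) (e x))) ∧
        (∀ x, CoalgebraStruct.counit (R := K) (e x) = CoalgebraStruct.counit (R := K) x) := by
  have h : IsHereditary (orderIdealFamily rootedForests) := isHereditary_rootedForests
  obtain ⟨f, hf, hf'⟩ := exists_hopfIso K h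
  refine ⟨fun P hP Q hQ => disjUnion_mem_rootedForests hP hQ,
    fun P hP s hs => subposet_mem_rootedForests hP hs, comul_forestElt K,
    -- The axioms are transported along the flip-free `f`, while `toForests` serves for the last
    -- claim.
    isHopf_incidence.of_algEquiv f hf hf', h, isHopf_incidence, ?_,
    toForests K h, toForests_idealsClass K h, map_toForests_comul K h, counit_toForests K h⟩
  exact ⟨{ f with
    map_smul' := map_smul f
    counit_comp := LinearMap.ext hf'
    map_comp_comul := LinearMap.ext fun a => (hf a).symm }⟩
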